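/- Let $R$ be a noetherian commutative ring and let $A$ be a Frobenius $R$-algebra, that is, a (not necessarily commutative) $R$-algebra which is finitely generated and projective as an $R$-module and satisfies $\operatorname{add}\omega_{A/R}=\operatorname{add}A$. Here $\omega_{A/R}=\operatorname{Hom}_R(A,R)$ is regarded as a left $A$-module via $(a\varphi)(x)=\varphi(xa)$, and, for a left $A$-module $W$, $\operatorname{add}W$ denotes the class of left $A$-modules that are direct summands of finite direct sums of copies of $W$. Let $M$ be a left $A$-module that is projective as an $R$-module. For a prime $\mathfrak p\in\operatorname{Spec}R$ with residue field $k(\mathfrak p)$, write $A_{k(\mathfrak p)}=A\otimes_R k(\mathfrak p)$ and $M_{k(\mathfrak p)}=M\otimes_R k(\mathfrak p)$, the latter regarded as a left $A_{k(\mathfrak p)}$-module. Then the following conditions are equivalent. 1. $M$ is a flat $A$-module. 2. $M$ is a projective $A$-module. 3. $M_{k(\mathfrak p)}$ is a projective $A_{k(\mathfrak p)}$-module for each $\mathfrak p\in\operatorname{Spec}R$. 4. $M_{k(\mathfrak p)}$ is a flat $A_{k(\mathfrak p)}$-module for each $\mathfrak p\in\operatorname{Spec}R$. -/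

import Mathlib

open scoped TensorProduct

noncomputable section

/-! ### Tensor products and flatness over a possibly noncommutative ring

Right `A`-modules are modules over `Aᵐᵒᵖ`. -/

section Flat

universe u v w

/-- The subgroup of `N ⊗[ℤ] M` generated by the elements `n a ⊗ m - n ⊗ a m`. -/
def balancedRelations (A : Type u) [Ring A] (N : Type v) [AddCommGroup N] [Module Aᵐᵒᵖ N]
    (M : Type w) [AddCommGroup M] [Module A M] : AddSubgroup (N ⊗[ℤ] M) :=
  AddSubgroup.closure
    {t | ∃ (n : N) (a : A) (m : M), t = (MulOpposite.op a • n) ⊗ₜ[ℤ] m - n ⊗ₜ[ℤ] (a • m)}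

/-- The tensor product `N ⊗_A M` of a right `A`-module `N` and a left `A`-module `M`. -/
abbrev BalancedTensor (A : Type u) [Ring A] (N : Type v) [AddCommGroup N] [Module Aᵐᵒᵖ N]
    (M : Type w) [AddCommGroup M] [Module A M] : Type (max v w) :=
  (N ⊗[ℤ] M) ⧸ balancedRelations A N M

/-- The map `f ⊗_A M : N ⊗_A M → P ⊗_A M` induced by a map `f : N → P` of right `A`-modules. -/
def BalancedTensor.map {A : Type u} [Ring A] {N P : Type v} [AddCommGroup N] [Module Aᵐᵒᵖ N]
    [AddCommGroup P] [Module Aᵐᵒᵖ P] (f : N →ₗ[Aᵐᵒᵖ] P)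
    (M : Type w) [AddCommGroup M] [Module A M] :
    BalancedTensor A N M →+ BalancedTensor A P M :=
  QuotientAddGroup.map _ _ (LinearMap.rTensor M f.toAddMonoidHom.toIntLinearMap).toAddMonoidHom (by
    refine (AddSubgroup.closure_le _).2 ?_
    rintro _ ⟨n, a, m, rfl⟩
    refine AddSubgroup.subset_closure ⟨f n, a, m, ?_⟩
    exact (map_sub _ _ _).trans (congrArg₂ (· - ·)
      (congrArg (· ⊗ₜ[ℤ] m) (f.map_smul (MulOpposite.op a) n)) rfl))

/-- A left `A`-module `M` is flat if `- ⊗_A M` preserves injectivity of maps of right `A`-modules.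
As usual, test modules in the universe of `A` suffice, since they include the right ideals. -/
def IsFlatModule (A : Type u) [Ring A] (M : Type w) [AddCommGroup M] [Module A M] : Prop :=
  ∀ (N P : Type u) [AddCommGroup N] [Module Aᵐᵒᵖ N] [AddCommGroup P] [Module Aᵐᵒᵖ P]
    (f : N →ₗ[Aᵐᵒᵖ] P), Function.Injective f → Function.Injective (BalancedTensor.map f M)

end Flat

/-! ### Frobenius algebras -/

section Frobenius

universe u v w

/-- The module `X` belongs to `add W`: it is a direct summand of a finite direct sum of copies
of `W`. -/
def InAdd (A : Type u) [Ring A] (W : Type v) [AddCommGroup W] [Module A W]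
    (X : Type w) [AddCommGroup X] [Module A X] : Prop :=
  ∃ (n : ℕ) (i : X →ₗ[A] (Fin n → W)) (r : (Fin n → W) →ₗ[A] X), r ∘ₗ i = LinearMap.id

/-- The dualising module `ω = Hom_R(A, R)`; its left `A`-module structure is
`(a • φ) x = φ (x * a)`. -/
def DualisingModule (R : Type u) (A : Type v) [CommRing R] [Ring A] [Algebra R A] :
    Type (max u v) :=
  A →ₗ[R] R

instance DualisingModule.instAddCommGroup (R : Type u) (A : Type v) [CommRing R] [Ring A]
    [Algebra R A] : AddCommGroup (DualisingModule R A) :=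
  inferInstanceAs (AddCommGroup (A →ₗ[R] R))

instance DualisingModule.instModule (R : Type u) (A : Type v) [CommRing R] [Ring A]
    [Algebra R A] : Module A (DualisingModule R A) where
  smul a φ := LinearMap.comp (show A →ₗ[R] R from φ) (LinearMap.mulRight R a)
  one_smul φ := LinearMap.ext fun x => congrArg (show A →ₗ[R] R from φ) (mul_one x)
  mul_smul a b φ := LinearMap.ext fun x =>
    congrArg (show A →ₗ[R] R from φ) (mul_assoc x a b).symm
  smul_zero _ := LinearMap.ext fun _ => rfl
  smul_add _ _ _ := LinearMap.ext fun _ => rfl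
  add_smul a b φ := LinearMap.ext fun x =>
    (congrArg (show A →ₗ[R] R from φ) (mul_add x a b)).trans
      (LinearMap.map_add (show A →ₗ[R] R from φ) _ _)
  zero_smul φ := LinearMap.ext fun x =>
    (congrArg (show A →ₗ[R] R from φ) (mul_zero x)).trans
      (LinearMap.map_zero (show A →ₗ[R] R from φ))

/-- The action on the dualising module is `(a • φ) x = φ (x * a)`. -/
theorem DualisingModule.smul_apply (R : Type u) (A : Type v) [CommRing R] [Ring A] [Algebra R A]
    (a : A) (φ : A →ₗ[R] R) (x : A) :
    (show A →ₗ[R] R from a • (show DualisingModule R A from φ)) x = φ (x * a) :=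
  rfl

/-- `A` is a Frobenius `R`-algebra: it is finitely generated and projective as an `R`-module, and
`add ω = add A` in the category of left `A`-modules. -/
structure IsFrobeniusAlgebra (R : Type u) (A : Type v) [CommRing R] [Ring A] [Algebra R A] :
    Prop where
  finite : Module.Finite R A
  projective : Module.Projective R A
  add_eq : ∀ (X : Type (max u v)) [AddCommGroup X] [Module A X],
    InAdd A (DualisingModule R A) X ↔ InAdd A A X

end Frobenius

/-! ### Fibres -/

section Fibre

universe u v w

/-- The fibre `k(p) ⊗[R] M` of an `A`-module `M` at a prime `p` of `R`. It carries the module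
structure over `p.asIdeal.Fiber A = k(p) ⊗[R] A` given below. -/
def ModuleFibre (R : Type u) (A : Type v) (M : Type w) [CommRing R] [Ring A] [Algebra R A]
    [AddCommGroup M] [Module R M] [Module A M] [IsScalarTower R A M] (p : PrimeSpectrum R) :
    Type (max u w) :=
  p.asIdeal.ResidueField ⊗[R] M

instance ModuleFibre.instAddCommGroup (R : Type u) (A : Type v) (M : Type w) [CommRing R]
    [Ring A] [Algebra R A] [AddCommGroup M] [Module R M] [Module A M] [IsScalarTower R A M] (p : PrimeSpectrum R) :
    AddCommGroup (ModuleFibre R A M p) :=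
  inferInstanceAs (AddCommGroup (p.asIdeal.ResidueField ⊗[R] M))

instance ModuleFibre.instModule (R : Type u) (A : Type v) (M : Type w) [CommRing R]
    [Ring A] [Algebra R A] [AddCommGroup M] [Module R M] [Module A M] [IsScalarTower R A M] (p : PrimeSpectrum R) :
    Module (p.asIdeal.Fiber A) (ModuleFibre R A M p) :=
  Module.compHom (p.asIdeal.ResidueField ⊗[R] M)
    ((Module.endTensorEndAlgHom (R := R) (S := R) (A := R)
        (M := p.asIdeal.ResidueField) (N := M)).comp
      (Algebra.TensorProduct.map (Algebra.lmul R p.asIdeal.ResidueField)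
        (Algebra.lsmul R R M : A →ₐ[R] Module.End R M))).toRingHom

/-- The action on the fibre is `(c ⊗ a) • (d ⊗ m) = c d ⊗ a m`. -/
theorem ModuleFibre.tmul_smul_tmul (R : Type u) (A : Type v) (M : Type w) [CommRing R] [Ring A]
    [Algebra R A] [AddCommGroup M] [Module R M] [Module A M] [IsScalarTower R A M]
    (p : PrimeSpectrum R) (c d : p.asIdeal.ResidueField) (a : A) (m : M) :
    (c ⊗ₜ[R] a : p.asIdeal.Fiber A) • (show ModuleFibre R A M p from d ⊗ₜ[R] m) =
      (show ModuleFibre R A M p from (c * d) ⊗ₜ[R] (a • m)) :=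
  rfl

end Fibre

end

/-! The implication that carries the proof is that an `R`-projective module `M` with flat fibres is
projective. Flatness is used in the form of the equational criterion, `EquationallyFlat`.

*Fibres.* The fibres `k(p) ⊗[R] ω` are dual to the finite-dimensional algebras `k(p) ⊗[R] A`, hence
injective, and since `A` is in `add ω`, the fibres of `A` are self-injective noetherian rings
(`IsFrobeniusAlgebra.baer_fibre`). Over such a ring flat modules are injective
(`LocallyFactorsFree.baer`). Over `R`, the module `M` is a direct summand of a free module, and
coextension of scalars embeds it in a direct sum of copies of `ω`, compatibly with a splitting over
`R` (`exists_embedding_dualising`). As `ω` is in `add A`, the fibres of that sum are projective, so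
flat fibres of `M` are direct summands of projective modules
(`projective_fibre_of_equationallyFlat`).

*Projective fibres imply flatness.* Take a presentation `0 → K → F → M → 0` with `F` free. It splits
over `R`, and `M` is flat when `K ∩ J F = J K` for all right ideals `J`. This follows by noetherian
induction on `J`, a dévissage that reduces to right ideals `J` for which `A / J` is torsion-free
over `R / p`, where `p = J ∩ R` is prime (`inter_rightIdealSMul_le`).

*Flatness implies projectivity.* If `M` is countably generated, embed it in a countable sum `H` of
copies of `ω`. The cokernel is again `R`-projective, and it has projective fibres since the fibres
of `M` are injective, so it is flat. Being countably generated, it is a direct limit of a sequence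
of free modules and has projective dimension at most one; therefore `M`, the kernel of `H → H / M`,
is projective (`projective_of_countablyGenerated`). In general, fix a splitting of `R^(I) → M` over
`R` and consider the submodules `N` of `M` that are adapted to it, so that `N` and `M ⧸ N` remain
`R`-projective. If such an `N` is projective, then `M ⧸ N` has projective fibres, hence is flat, and
a countably generated adapted submodule of `M ⧸ N` is projective and lifts to a complement of `N` in
a larger adapted submodule (`exists_adapted_extension`). By Zorn's lemma `M` is a direct sum of
projective modules. -/

noncomputable section

/-! ### The equational criterion for flatness -/

section Equational

variable {A : Type*} [Ring A] {M : Type*} [AddCommGroup M] [Module A M]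

/-- The equational criterion for flatness: every relation `∑ i, a i • m i = 0` in the left module
`M` is a consequence of relations `∑ i, a i * b i j = 0` in `A`. Only this form of flatness is
manipulated; it makes no reference to test modules, hence to no universe. -/
def EquationallyFlat (A : Type*) [Ring A] (M : Type*) [AddCommGroup M] [Module A M] : Prop :=
  ∀ (n : ℕ) (a : Fin n → A) (m : Fin n → M), ∑ i, a i • m i = 0 →
    ∃ (k : ℕ) (b : Fin n → Fin k → A) (y : Fin k → M),
      (∀ i, m i = ∑ j, b i j • y j) ∧ ∀ j, ∑ i, a i * b i j = 0

/-- The inclusion of every finitely generated submodule of `M` factors through a finite free module.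
-/
def LocallyFactorsFree (A : Type*) [Ring A] (M : Type*) [AddCommGroup M] [Module A M] : Prop :=
  ∀ F : Submodule A M, F.FG → ∃ (n : ℕ) (α : F →ₗ[A] (Fin n → A)) (β : (Fin n → A) →ₗ[A] M),
    β ∘ₗ α = F.subtype

theorem EquationallyFlat.exists_of_fintype (h : EquationallyFlat A M) {ι : Type*} [Fintype ι]
    (a : ι → A) (m : ι → M) (h0 : ∑ i, a i • m i = 0) :
    ∃ (k : ℕ) (b : ι → Fin k → A) (y : Fin k → M),
      (∀ i, m i = ∑ j, b i j • y j) ∧ ∀ j, ∑ i, a i * b i j = 0 := by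
  let e := Fintype.equivFin ι
  obtain ⟨k, b, y, h1, h2⟩ := h _ (a ∘ e.symm) (m ∘ e.symm) (by
    rw [← h0]; exact Equiv.sum_comp e.symm (fun i => a i • m i))
  refine ⟨k, b ∘ e, y, fun i => by simpa using h1 (e i), fun j => ?_⟩
  rw [← h2 j]
  exact (Equiv.sum_comp e.symm (fun i => a i * b (e i) j)).symm.trans (by simp)

/-- A tuple `m` that is a sum of tuples `(c i • y)ᵢ` with `∑ i, a i * c i = 0` satisfies the
conclusion of the equational criterion for the coefficients `a`. -/
theorem exists_trivial_of_mem_closure {n : ℕ} (a : Fin n → A) {m : Fin n → M}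
    (hm : m ∈ AddSubgroup.closure {m : Fin n → M | ∃ (c : Fin n → A) (y : M),
      ∑ i, a i * c i = 0 ∧ m = fun i => c i • y}) :
    ∃ (k : ℕ) (b : Fin n → Fin k → A) (y : Fin k → M),
      (∀ i, m i = ∑ j, b i j • y j) ∧ ∀ j, ∑ i, a i * b i j = 0 := by
  induction hm using AddSubgroup.closure_induction with
  | mem m hm =>
    obtain ⟨c, y, hc, rfl⟩ := hm
    exact ⟨1, fun i _ => c i, fun _ => y, by simp, by simpa using hc⟩
  | zero => exact ⟨0, fun _ => Fin.elim0, Fin.elim0, by simp, fun j => j.elim0⟩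
  | add m m' _ _ h h' =>
    obtain ⟨k, b, y, h1, h2⟩ := h
    obtain ⟨k', b', y', h1', h2'⟩ := h'
    refine ⟨k + k', fun i => Fin.append (b i) (b' i), Fin.append y y', fun i => ?_, fun j => ?_⟩
    · simp [Fin.sum_univ_add, h1, h1']
    · induction j using Fin.addCases with
      | left j => simpa using h2 j
      | right j => simpa using h2' j
  | neg m _ h =>
    obtain ⟨k, b, y, h1, h2⟩ := h
    exact ⟨k, b, -y, by simp [h1], h2⟩

end Equational

/-! ### Tensor products over a noncommutative ring; flat and projective modules -/

section OfFlat

universe u w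
variable {A : Type u} [Ring A] {M : Type w} [AddCommGroup M] [Module A M]

/-- The additive map on `N ⊗_A M` induced by an `A`-balanced biadditive map `N × M → X`. -/
def BalancedTensor.lift {N : Type*} [AddCommGroup N] [Module Aᵐᵒᵖ N] {X : Type*} [AddCommGroup X]
    (f : N →+ M →+ X) (hf : ∀ n (a : A) m, f (MulOpposite.op a • n) m = f n (a • m)) :
    BalancedTensor A N M →+ X :=
  QuotientAddGroup.lift _ (TensorProduct.liftAddHom f (fun z n m => by simp)) (by
    refine (AddSubgroup.closure_le _).2 ?_
    rintro _ ⟨n, a, m, rfl⟩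
    simp [hf])

/-- The pure tensor `n ⊗ m` in `N ⊗_A M`. -/
def BalancedTensor.tmul {N : Type*} [AddCommGroup N] [Module Aᵐᵒᵖ N] (n : N) (m : M) :
    BalancedTensor A N M :=
  QuotientAddGroup.mk (n ⊗ₜ[ℤ] m)

theorem BalancedTensor.lift_tmul {N : Type*} [AddCommGroup N] [Module Aᵐᵒᵖ N] {X : Type*}
    [AddCommGroup X] (f : N →+ M →+ X)
    (hf : ∀ n (a : A) m, f (MulOpposite.op a • n) m = f n (a • m)) (n : N) (m : M) :
    BalancedTensor.lift f hf (BalancedTensor.tmul n m) = f n m :=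
  rfl

theorem BalancedTensor.map_tmul {N P : Type u} [AddCommGroup N] [Module Aᵐᵒᵖ N]
    [AddCommGroup P] [Module Aᵐᵒᵖ P] (f : N →ₗ[Aᵐᵒᵖ] P) (n : N) (m : M) :
    BalancedTensor.map f M (BalancedTensor.tmul n m) = BalancedTensor.tmul (f n) m := rfl

theorem BalancedTensor.smul_tmul {N : Type*} [AddCommGroup N] [Module Aᵐᵒᵖ N] (n : N) (a : A)
    (m : M) : (BalancedTensor.tmul (MulOpposite.op a • n) m : BalancedTensor A N M) =
      BalancedTensor.tmul n (a • m) := by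
  rw [← sub_eq_zero]
  exact (QuotientAddGroup.eq_zero_iff _).2 (AddSubgroup.subset_closure ⟨n, a, m, rfl⟩)

/-- The canonical biadditive map `N × M → N ⊗_A M`. -/
def BalancedTensor.mk (A : Type*) [Ring A] (N M : Type*) [AddCommGroup N] [Module Aᵐᵒᵖ N]
    [AddCommGroup M] [Module A M] : N →+ M →+ BalancedTensor A N M where
  toFun n :=
    { toFun := fun m => BalancedTensor.tmul n m
      map_zero' := by simp [BalancedTensor.tmul]
      map_add' := fun m m' => by simp [BalancedTensor.tmul, TensorProduct.tmul_add] }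
  map_zero' := by ext; simp [BalancedTensor.tmul]
  map_add' n n' := by ext; simp [BalancedTensor.tmul, TensorProduct.add_tmul]

theorem BalancedTensor.mk_apply {N : Type*} [AddCommGroup N] [Module Aᵐᵒᵖ N] (n : N) (m : M) :
    BalancedTensor.mk A N M n m = BalancedTensor.tmul n m := rfl

theorem BalancedTensor.hom_ext {N : Type*} [AddCommGroup N] [Module Aᵐᵒᵖ N] {X : Type*}
    [AddCommGroup X] {f g : BalancedTensor A N M →+ X}
    (h : ∀ n m, f (BalancedTensor.tmul n m) = g (BalancedTensor.tmul n m)) : f = g := by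
  refine QuotientAddGroup.addMonoidHom_ext _ ?_
  ext t
  induction t with
  | zero => simp
  | tmul n m => exact h n m
  | add t t' ht ht' => rw [map_add, map_add, ht, ht']

/-- Flatness, tested on the inclusion in `A` of the right ideal `J = ∑ i, a i A`, gives the
equational criterion for the relation `∑ i, a i • m i = 0`. The tensor `∑ i, a i ⊗ m i` vanishes in
`J ⊗_A M`, and this group maps to `Mⁿ` modulo the trivial solutions `T` by sending `x ⊗ y` to the
class of `(c i • y)ᵢ` for any `c` with `∑ i, a i * c i = x`; the image of `∑ i, a i ⊗ m i` is the
class of `m`. -/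
theorem IsFlatModule.equationallyFlat (h : IsFlatModule A M) : EquationallyFlat A M := by
  classical
  intro n a m h0
  apply exists_trivial_of_mem_closure
  set T := AddSubgroup.closure {m : Fin n → M | ∃ (c : Fin n → A) (y : M),
      ∑ i, a i * c i = 0 ∧ m = fun i => c i • y} with hT
  have key : ∀ (c : Fin n → A) (y : M), ∑ i, a i * c i = 0 → (fun i => c i • y) ∈ T :=
    fun c y hc => AddSubgroup.subset_closure ⟨c, y, hc, rfl⟩
  let J : Submodule Aᵐᵒᵖ A := Submodule.span Aᵐᵒᵖ (Set.range a)
  have hJ : ∀ x : J, ∃ c : Fin n → A, ∑ i, a i * c i = x := by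
    rintro ⟨x, hx⟩
    obtain ⟨c, hc⟩ := (Submodule.mem_span_range_iff_exists_fun _).1 hx
    exact ⟨fun i => (c i).unop, by simpa using hc⟩
  -- `c x` expresses `x ∈ J` in the generators, not additively; the error is a trivial solution
  choose c hc using hJ
  let f : J →+ M →+ (Fin n → M) ⧸ T := AddMonoidHom.mk' (fun x =>
      AddMonoidHom.mk' (fun y => QuotientAddGroup.mk fun i => c x i • y) (fun y y' => by
        rw [← QuotientAddGroup.mk_add]; congr 1; ext i; simp))
    (fun x x' => by
      ext y
      simp only [AddMonoidHom.mk'_apply, AddMonoidHom.add_apply]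
      rw [← QuotientAddGroup.mk_add, QuotientAddGroup.eq]
      convert key (fun i => - c (x + x') i + (c x i + c x' i)) y ?_ using 1
      · ext i; simp [add_smul]
      · simp only [mul_add, mul_neg, Finset.sum_add_distrib, Finset.sum_neg_distrib, hc]; simp)
  have hf : ∀ x (b : A) y, f (MulOpposite.op b • x) y = f x (b • y) := by
    intro x b y
    refine QuotientAddGroup.eq.2 ?_
    convert key (fun i => - c (MulOpposite.op b • x) i + c x i * b) y ?_ using 1
    · ext i; simp [add_smul, mul_smul]
    · simp only [mul_add, mul_neg, Finset.sum_add_distrib, Finset.sum_neg_distrib, hc, ← mul_assoc,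
        ← Finset.sum_mul]
      simp
  have haJ : ∀ i, a i ∈ J := fun i => Submodule.subset_span ⟨i, rfl⟩
  have h1 : ∑ i, BalancedTensor.tmul (⟨a i, haJ i⟩ : J) (m i) = (0 : BalancedTensor A J M) := by
    apply h J A J.subtype J.subtype_injective
    rw [map_sum, map_zero]
    have : ∀ i, BalancedTensor.map J.subtype M (BalancedTensor.tmul (⟨a i, haJ i⟩ : J) (m i)) =
        BalancedTensor.mk A A M 1 (a i • m i) := by
      intro i
      rw [BalancedTensor.map_tmul, BalancedTensor.mk_apply, ← BalancedTensor.smul_tmul]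
      simp
    simp_rw [this, ← map_sum, h0, map_zero]
  have h2 := congrArg (BalancedTensor.lift f hf) h1
  rw [map_sum, map_zero] at h2
  simp_rw [BalancedTensor.lift_tmul] at h2
  -- `c (a i)` and the `i`-th unit vector both express `a i`
  have h3 : ∀ i, f ⟨a i, haJ i⟩ (m i) = QuotientAddGroup.mk (Pi.single i (m i)) := by
    intro i
    refine QuotientAddGroup.eq.2 ?_
    convert key (fun l => - c ⟨a i, haJ i⟩ l + Pi.single (M := fun _ => A) i 1 l) (m i) ?_ using 1
    · ext l
      by_cases hl : l = i
      · subst hl; simp [add_smul]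
      · simp [hl]
    · simp only [mul_add, mul_neg, Finset.sum_add_distrib, Finset.sum_neg_distrib, hc]
      simp [Pi.single_apply]
  simp_rw [h3] at h2
  rw [← QuotientAddGroup.mk_sum, QuotientAddGroup.eq_zero_iff, Finset.univ_sum_single] at h2
  exact h2

/-- A projective module is flat: a section `s` of the canonical map `A^(M) → M` embeds `N ⊗_A M` in
`N^(M)`, naturally in `N`. -/
theorem IsFlatModule.of_projective (h : Module.Projective A M) : IsFlatModule A M := by
  classical
  obtain ⟨s, hs⟩ := Module.projective_def'.1 h
  intro N P _ _ _ _ f hf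
  -- the embedding `n ⊗ m ↦ (n (s m x))ₓ`, and its retraction `Θ`
  let E : ∀ (N : Type u) [AddCommGroup N] [Module Aᵐᵒᵖ N], BalancedTensor A N M →+ (M →₀ N) :=
    fun N _ _ => BalancedTensor.lift
      (AddMonoidHom.mk' (fun n => AddMonoidHom.mk' (fun m =>
          (s m).mapRange (fun a => MulOpposite.op a • n) (by simp))
        (fun m m' => by ext; simp [add_smul]))
        (fun n n' => by ext; simp))
      (fun n a m => by ext; simp [mul_smul])
  let Θ : (M →₀ N) →+ BalancedTensor A N M :=
    Finsupp.liftAddHom fun m => (BalancedTensor.mk A N M).flip m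
  have hΘ : ∀ t, Θ (E N t) = t := by
    intro t
    have : Θ.comp (E N) = AddMonoidHom.id _ := by
      refine BalancedTensor.hom_ext fun n m => ?_
      have hm : (s m).sum (fun x a => a • x) = m := congr($hs m)
      simp only [E, Θ, AddMonoidHom.comp_apply, BalancedTensor.lift_tmul, AddMonoidHom.mk'_apply,
        AddMonoidHom.id_apply]
      rw [Finsupp.liftAddHom_apply, Finsupp.sum_mapRange_index (by simp)]
      simp only [AddMonoidHom.flip_apply, BalancedTensor.mk_apply, BalancedTensor.smul_tmul]
      conv_rhs => rw [← hm, ← BalancedTensor.mk_apply]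
      rw [Finsupp.sum, Finsupp.sum, map_sum]
      rfl
    exact congr($this t)
  have hE : ∀ t, E P (BalancedTensor.map f M t) = (E N t).mapRange f (map_zero f) := by
    intro t
    have : (E P).comp (BalancedTensor.map f M) =
        (Finsupp.mapRange.addMonoidHom f.toAddMonoidHom).comp (E N) := by
      refine BalancedTensor.hom_ext fun n m => ?_
      simp only [E, AddMonoidHom.comp_apply, BalancedTensor.map_tmul, BalancedTensor.lift_tmul]
      ext; simp
    exact congr($this t)
  rw [injective_iff_map_eq_zero]
  intro t ht
  have h1 := hE t
  rw [ht, map_zero] at h1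
  have h2 : E N t = 0 := by
    ext x
    exact hf (by simpa using congr($h1.symm x))
  rw [← hΘ t, h2, map_zero]

end OfFlat

/-! ### Factoring maps to flat modules through free modules -/

section Factor

variable {A : Type*} [Ring A] {M : Type*} [AddCommGroup M] [Module A M]

theorem apply_eq_sum_smul_single {ι : Type*} [Fintype ι] [DecidableEq ι] (φ : (ι → A) →ₗ[A] M)
    (x : ι → A) : φ x = ∑ i, x i • φ (Pi.single i 1) := by
  simp_rw [← map_smul, ← map_sum]
  congr 1
  ext j
  simp [Finset.sum_apply, Pi.single_apply]

/-- A map from a finite free module to `M` that kills finitely many vectors factors through a finite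
free module in which these vectors already become zero. -/
theorem EquationallyFlat.exists_factor (h : EquationallyFlat A M) (s : ℕ) :
    ∀ (n : ℕ) (x : Fin s → Fin n → A) (φ : (Fin n → A) →ₗ[A] M), (∀ j, φ (x j) = 0) →
    ∃ (k : ℕ) (α : (Fin n → A) →ₗ[A] (Fin k → A)) (β : (Fin k → A) →ₗ[A] M),
      β ∘ₗ α = φ ∧ ∀ j, α (x j) = 0 := by
  classical
  induction s with
  | zero => exact fun n x φ _ => ⟨n, LinearMap.id, φ, rfl, fun j => j.elim0⟩
  | succ s ih =>
    intro n x φ hx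
    have h0 : ∑ i, x 0 i • φ (Pi.single i 1) = 0 := by
      rw [← hx 0, apply_eq_sum_smul_single φ (x 0)]
    -- kill the vector `x 0` by the equational criterion, and the other ones by induction
    obtain ⟨k, b, y, h1, h2⟩ := h _ _ _ h0
    have hφ : Fintype.linearCombination A y ∘ₗ Fintype.linearCombination A b = φ := by
      refine LinearMap.pi_ext' fun i => LinearMap.ext_ring ?_
      simp [Fintype.linearCombination_apply, h1]
    obtain ⟨k', α, β, h3, h4⟩ := ih k (fun j => Fintype.linearCombination A b (x j.succ))
      (Fintype.linearCombination A y) (fun j => by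
        rw [← LinearMap.comp_apply, hφ]; exact hx _)
    refine ⟨k', α ∘ₗ Fintype.linearCombination A b, β, ?_, fun j => ?_⟩
    · rw [← LinearMap.comp_assoc, h3, hφ]
    · induction j using Fin.cases with
      | zero =>
        have : Fintype.linearCombination A b (x 0) = 0 := by
          ext j; simpa [Fintype.linearCombination_apply] using h2 j
        simp [this]
      | succ j => exact h4 j

/-- Over a left noetherian ring a finitely generated submodule is finitely presented, so that its
inclusion in a flat module factors through a finite free module. -/
theorem EquationallyFlat.locallyFactorsFree [IsNoetherianRing A] (h : EquationallyFlat A M) :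
    LocallyFactorsFree A M := by
  classical
  intro F hF
  obtain ⟨n, m, hm⟩ := Submodule.fg_iff_exists_fin_generating_family.1 hF
  let φ := Fintype.linearCombination A m
  have hφ : LinearMap.range φ = F := by
    rw [Fintype.range_linearCombination, hm]
  obtain ⟨s, x, hx⟩ := Submodule.fg_iff_exists_fin_generating_family.1
    (IsNoetherian.noetherian (LinearMap.ker φ))
  obtain ⟨k, α, β, h1, h2⟩ := h.exists_factor s n x φ (fun j => by
    have : x j ∈ LinearMap.ker φ := hx ▸ Submodule.subset_span ⟨j, rfl⟩
    exact this)
  have hle : LinearMap.ker φ ≤ LinearMap.ker α := by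
    rw [← hx, Submodule.span_le]
    rintro _ ⟨j, rfl⟩
    exact h2 j
  subst hφ
  refine ⟨k, (LinearMap.ker φ).liftQ α hle ∘ₗ φ.quotKerEquivRange.symm.toLinearMap, β, ?_⟩
  ext ⟨_, v, rfl⟩
  have : φ.quotKerEquivRange.symm ⟨φ v, v, rfl⟩ = (LinearMap.ker φ).mkQ v := by
    rw [LinearEquiv.symm_apply_eq]; rfl
  simp only [LinearMap.comp_apply, LinearEquiv.coe_coe, Submodule.subtype_apply]
  erw [this]
  simp [← h1]

theorem LocallyFactorsFree.exists_comp_eq (h : LocallyFactorsFree A M) {X : Type*}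
    [AddCommGroup X] [Module A X] [Module.Finite A X] (f : X →ₗ[A] M) :
    ∃ (n : ℕ) (α : X →ₗ[A] (Fin n → A)) (β : (Fin n → A) →ₗ[A] M), β ∘ₗ α = f := by
  obtain ⟨n, α, β, hαβ⟩ := h (LinearMap.range f) (by
    rw [LinearMap.range_eq_map]; exact Module.Finite.fg_top.map f)
  refine ⟨n, α ∘ₗ f.rangeRestrict, β, ?_⟩
  rw [← LinearMap.comp_assoc, hαβ]; rfl

/-- Over a left noetherian ring that is injective over itself, flat modules are injective: a map
from a left ideal to a flat module factors through a finite free, hence injective, module. -/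
theorem LocallyFactorsFree.baer [IsNoetherianRing A] (h : LocallyFactorsFree A M)
    (hA : Module.Baer A A) : Module.Baer A M := by
  intro I g
  obtain ⟨n, α, β, hαβ⟩ := h.exists_comp_eq g
  choose γ hγ using fun i => hA I (LinearMap.proj i ∘ₗ α)
  refine ⟨β ∘ₗ LinearMap.pi γ, fun x hx => ?_⟩
  rw [← hαβ]
  simp only [LinearMap.comp_apply]
  congr 1
  ext i
  exact hγ i x hx

theorem Module.Baer.exists_retraction {X : Type*} [AddCommGroup X] [Module A X]
    (h : Module.Baer A M) (f : M →ₗ[A] X) (hf : Function.Injective f) :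
    ∃ r : X →ₗ[A] M, r ∘ₗ f = LinearMap.id :=
  h.extension_property f hf LinearMap.id

theorem Module.Baer.projective_of_injective {X : Type*} [AddCommGroup X] [Module A X]
    (h : Module.Baer A M) (f : M →ₗ[A] X) (hf : Function.Injective f) [Module.Projective A X] :
    Module.Projective A M := by
  obtain ⟨r, hr⟩ := h.exists_retraction f hf
  exact Module.Projective.of_split f r hr

end Factor

/-! ### Split short exact sequences -/

section ShortExact

variable {B : Type*} [Ring B] {X Y Z : Type*} [AddCommGroup X] [AddCommGroup Y] [AddCommGroup Z]
  [Module B X] [Module B Y] [Module B Z]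

theorem exists_section_of_retraction {f : X →ₗ[B] Y} {g : Y →ₗ[B] Z} (hfg : Function.Exact f g)
    (hg : Function.Surjective g) {r : Y →ₗ[B] X} (hr : r ∘ₗ f = LinearMap.id) :
    ∃ s : Z →ₗ[B] Y, g ∘ₗ s = LinearMap.id := by
  have h : Function.Surjective g ∧ ∃ r, r ∘ₗ f = LinearMap.id := ⟨hg, r, hr⟩
  have h' : Function.Injective f ∧ ∃ s, g ∘ₗ s = LinearMap.id := (hfg.split_tfae'.out 1 0).1 h
  exact h'.2

theorem projective_right_of_retraction {f : X →ₗ[B] Y} {g : Y →ₗ[B] Z}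
    (hfg : Function.Exact f g) (hg : Function.Surjective g) {r : Y →ₗ[B] X}
    (hr : r ∘ₗ f = LinearMap.id) [Module.Projective B Y] : Module.Projective B Z := by
  obtain ⟨s, hs⟩ := exists_section_of_retraction hfg hg hr
  exact Module.Projective.of_split s g hs

theorem exists_retraction_of_projective_right {f : X →ₗ[B] Y} {g : Y →ₗ[B] Z}
    (hf : Function.Injective f) (hfg : Function.Exact f g) (hg : Function.Surjective g)
    [Module.Projective B Z] : ∃ r : Y →ₗ[B] X, r ∘ₗ f = LinearMap.id := by
  obtain ⟨s, hs⟩ := Module.projective_lifting_property g LinearMap.id hg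
  have h : Function.Injective f ∧ ∃ s, g ∘ₗ s = LinearMap.id := ⟨hf, s, hs⟩
  have h' : Function.Surjective g ∧ ∃ r, r ∘ₗ f = LinearMap.id := (hfg.split_tfae'.out 0 1).1 h
  exact h'.2

theorem projective_left_of_exact {f : X →ₗ[B] Y} {g : Y →ₗ[B] Z}
    (hf : Function.Injective f) (hfg : Function.Exact f g) (hg : Function.Surjective g)
    [Module.Projective B Y] [Module.Projective B Z] : Module.Projective B X := by
  obtain ⟨r, hr⟩ := exists_retraction_of_projective_right hf hfg hg
  exact Module.Projective.of_split f r hr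

end ShortExact

/-! ### Fibres at primes of the base ring -/

section Fibre

variable {R : Type*} {A : Type*} [CommRing R] [Ring A] [Algebra R A]
  {M : Type*} [AddCommGroup M] [Module R M] [Module A M] [IsScalarTower R A M]
  {N : Type*} [AddCommGroup N] [Module R N] [Module A N] [IsScalarTower R A N]
  {L : Type*} [AddCommGroup L] [Module R L] [Module A L] [IsScalarTower R A L]
  {p : PrimeSpectrum R}

/-- The pure tensor `c ⊗ m` in the fibre of `M` at `p`. -/
def ModuleFibre.mk (A : Type*) [Ring A] [Algebra R A] [Module A M] [IsScalarTower R A M]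
    (p : PrimeSpectrum R) (c : p.asIdeal.ResidueField) (m : M) : ModuleFibre R A M p :=
  c ⊗ₜ[R] m

theorem ModuleFibre.smul_mk (c d : p.asIdeal.ResidueField) (a : A) (m : M) :
    (c ⊗ₜ[R] a : p.asIdeal.Fiber A) • ModuleFibre.mk A p d m = ModuleFibre.mk A p (c * d) (a • m) :=
  rfl

theorem ModuleFibre.mk_add (c : p.asIdeal.ResidueField) (m n : M) :
    ModuleFibre.mk A p c (m + n) = ModuleFibre.mk A p c m + ModuleFibre.mk A p c n :=
  TensorProduct.tmul_add _ _ _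

theorem ModuleFibre.mk_smul (r : R) (c : p.asIdeal.ResidueField) (m : M) :
    ModuleFibre.mk A p c (r • m) = ModuleFibre.mk A p (r • c) m :=
  (TensorProduct.smul_tmul _ _ _).symm

/-- The map `m ↦ c ⊗ m` to the fibre as a homomorphism of groups. -/
def ModuleFibre.mkHom (A : Type*) [Ring A] [Algebra R A] [Module A M] [IsScalarTower R A M]
    (p : PrimeSpectrum R) (c : p.asIdeal.ResidueField) : M →+ ModuleFibre R A M p :=
  AddMonoidHom.mk' (ModuleFibre.mk A p c) (ModuleFibre.mk_add c)

theorem ModuleFibre.mkHom_apply (c : p.asIdeal.ResidueField) (m : M) :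
    ModuleFibre.mkHom A p c m = ModuleFibre.mk A p c m := rfl

theorem ModuleFibre.mk_sum {ι : Type*} (s : Finset ι) (c : p.asIdeal.ResidueField) (m : ι → M) :
    ModuleFibre.mk A p c (∑ i ∈ s, m i) = ∑ i ∈ s, ModuleFibre.mk A p c (m i) :=
  map_sum (ModuleFibre.mkHom A p c) m s

@[elab_as_elim]
theorem ModuleFibre.induction {motive : ModuleFibre R A M p → Prop} (t : ModuleFibre R A M p)
    (zero : motive 0) (mk : ∀ c m, motive (ModuleFibre.mk A p c m))
    (add : ∀ t t', motive t → motive t' → motive (t + t')) : motive t :=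
  TensorProduct.induction_on t zero mk add

/-- An additive map on `k(p) ⊗[R] M` that is compatible with the action of pure tensors `c ⊗ a` is
linear over the fibre of `A`. -/
def ModuleFibre.lift {Y : Type*} [AddCommGroup Y] [Module (p.asIdeal.Fiber A) Y]
    (f : p.asIdeal.ResidueField ⊗[R] M →+ Y)
    (hf : ∀ (c d : p.asIdeal.ResidueField) (a : A) (m : M),
      f ((c * d) ⊗ₜ[R] (a • m)) = (c ⊗ₜ[R] a : p.asIdeal.Fiber A) • f (d ⊗ₜ[R] m)) :
    ModuleFibre R A M p →ₗ[p.asIdeal.Fiber A] Y where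
  toFun t := f t
  map_add' := f.map_add
  map_smul' α t := by
    induction α using TensorProduct.induction_on with
    | zero => rw [zero_smul, RingHom.id_apply, zero_smul]; exact f.map_zero
    | add α α' h h' =>
      rw [add_smul, RingHom.id_apply, add_smul]
      exact (f.map_add _ _).trans (congrArg₂ _ h h')
    | tmul c a =>
      induction t using ModuleFibre.induction with
      | zero =>
        rw [smul_zero]
        exact f.map_zero.trans ((congrArg _ f.map_zero).trans (smul_zero _)).symm
      | mk d m => exact hf c d a m
      | add t t' h h' =>
        rw [smul_add]
        refine (f.map_add _ _).trans ((congrArg₂ _ h h').trans ?_)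
        exact ((congrArg _ (f.map_add _ _)).trans (smul_add _ _ _)).symm

theorem ModuleFibre.hom_ext {Y : Type*} [AddCommGroup Y] [Module (p.asIdeal.Fiber A) Y]
    {f g : ModuleFibre R A M p →ₗ[p.asIdeal.Fiber A] Y}
    (h : ∀ m, f (ModuleFibre.mk A p 1 m) = g (ModuleFibre.mk A p 1 m)) : f = g := by
  ext t
  induction t using ModuleFibre.induction with
  | zero => simp
  | add t t' ht ht' => simp [ht, ht']
  | mk c m =>
    have : ModuleFibre.mk A p c m =
        (c ⊗ₜ[R] (1 : A) : p.asIdeal.Fiber A) • ModuleFibre.mk A p 1 m := by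
      rw [ModuleFibre.smul_mk, mul_one, one_smul]
    rw [this, map_smul, map_smul, h]

/-- The map on fibres at `p` induced by an `A`-linear map. -/
def ModuleFibre.map (p : PrimeSpectrum R) (f : M →ₗ[A] N) :
    ModuleFibre R A M p →ₗ[p.asIdeal.Fiber A] ModuleFibre R A N p :=
  ModuleFibre.lift (Y := ModuleFibre R A N p)
    ((f.restrictScalars R).lTensor p.asIdeal.ResidueField).toAddMonoidHom (fun c d a m =>
      (congrArg (fun n => ModuleFibre.mk A p (c * d) n) (f.map_smul a m)))

theorem ModuleFibre.map_mk (f : M →ₗ[A] N) (c : p.asIdeal.ResidueField) (m : M) :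
    ModuleFibre.map p f (ModuleFibre.mk A p c m) = ModuleFibre.mk A p c (f m) := rfl

theorem ModuleFibre.map_comp (f : M →ₗ[A] N) (g : N →ₗ[A] L) :
    ModuleFibre.map p (g ∘ₗ f) = ModuleFibre.map p g ∘ₗ ModuleFibre.map p f :=
  ModuleFibre.hom_ext fun _ => rfl

theorem ModuleFibre.map_id :
    ModuleFibre.map p (LinearMap.id : M →ₗ[A] M) = LinearMap.id :=
  ModuleFibre.hom_ext fun _ => rfl

theorem ModuleFibre.map_surjective {g : M →ₗ[A] N} (hg : Function.Surjective g) :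
    Function.Surjective (ModuleFibre.map p g) :=
  LinearMap.lTensor_surjective (g := g.restrictScalars R) p.asIdeal.ResidueField hg

theorem ModuleFibre.map_exact {f : M →ₗ[A] N} {g : N →ₗ[A] L} (hfg : Function.Exact f g)
    (hg : Function.Surjective g) :
    Function.Exact (ModuleFibre.map p f) (ModuleFibre.map p g) :=
  lTensor_exact (f := f.restrictScalars R) (g := g.restrictScalars R)
    p.asIdeal.ResidueField hfg hg

/-- An `A`-linear map that is split injective over the base ring `R` stays injective on fibres. -/
theorem ModuleFibre.map_injective {f : M →ₗ[A] N} {ρ : N →ₗ[R] M} (h : ∀ m, ρ (f m) = m) :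
    Function.Injective (ModuleFibre.map p f) := by
  refine Function.LeftInverse.injective (g := ρ.lTensor p.asIdeal.ResidueField) fun t => ?_
  refine (LinearMap.lTensor_comp_apply p.asIdeal.ResidueField ρ
    (f.restrictScalars R) t).symm.trans ?_
  have : ρ ∘ₗ f.restrictScalars R = LinearMap.id := LinearMap.ext h
  rw [this]
  exact LinearMap.lTensor_id_apply _ _ t

/-- Denominators can be cleared: up to a unit coming from `R`, every element of the fibre is of the
form `1 ⊗ m`. -/
theorem ModuleFibre.exists_smul_eq_mk (t : ModuleFibre R A M p) :
    ∃ s ∉ p.asIdeal, ∃ m : M,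
      (algebraMap R p.asIdeal.ResidueField s ⊗ₜ[R] (1 : A) : p.asIdeal.Fiber A) • t =
        ModuleFibre.mk A p 1 m := by
  induction t using ModuleFibre.induction with
  | zero =>
    exact ⟨1, p.asIdeal.one_notMem, 0, (smul_zero _).trans (TensorProduct.tmul_zero _ _).symm⟩
  | mk c m =>
    obtain ⟨r, hr, s, hs⟩ := Ideal.ResidueField.exists_smul_eq_tmul_one (S := R) p.asIdeal
      ((1 : R) ⊗ₜ[R] c)
    refine ⟨r, hr, s • m, ?_⟩
    rw [ModuleFibre.smul_mk, one_smul, ModuleFibre.mk_smul]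
    congr 1
    simpa [Algebra.smul_def] using congr(TensorProduct.lid R _ $hs)
  | add t t' h h' =>
    obtain ⟨s, hs, m, hm⟩ := h
    obtain ⟨s', hs', m', hm'⟩ := h'
    refine ⟨s * s', fun h => (p.isPrime.mem_or_mem h).elim hs hs', s' • m + s • m', ?_⟩
    have e (r r' : R) (m : M) : ModuleFibre.mk A p 1 (r • m) =
        (algebraMap R p.asIdeal.ResidueField r ⊗ₜ[R] (1 : A) : p.asIdeal.Fiber A) •
          ModuleFibre.mk A p 1 m := by
      rw [ModuleFibre.smul_mk, ModuleFibre.mk_smul, one_smul, Algebra.smul_def]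
    rw [ModuleFibre.mk_add, e s' s', e s s, ← hm, ← hm', ← mul_smul, ← mul_smul, smul_add]
    simp [mul_comm]

theorem ModuleFibre.mk_eq_zero_of_mem (c : p.asIdeal.ResidueField) {m : M}
    (hm : m ∈ p.asIdeal • (⊤ : Submodule R M)) : ModuleFibre.mk A p c m = 0 := by
  induction hm using Submodule.smul_induction_on' with
  | smul r hr m _ =>
    rw [ModuleFibre.mk_smul, Algebra.smul_def, Ideal.algebraMap_residueField_eq_zero.2 hr, zero_mul]
    exact TensorProduct.zero_tmul _ _
  | add x _ y _ hx hy => rw [ModuleFibre.mk_add, hx, hy, add_zero]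

/-- The fibre at `p` is the localization of `M / pM` away from `R ∖ p`, hence `1 ⊗ m = 0` only if `s
• m ∈ p M` for some `s ∉ p`. -/
theorem ModuleFibre.exists_smul_mem_of_mk_eq_zero {m : M} (hm : ModuleFibre.mk A p 1 m = 0) :
    ∃ s ∉ p.asIdeal, s • m ∈ p.asIdeal • (⊤ : Submodule R M) := by
  have h1 : TensorProduct.mk (R ⧸ p.asIdeal) p.asIdeal.ResidueField ((R ⧸ p.asIdeal) ⊗[R] M) 1
      (1 ⊗ₜ[R] m) = 0 := by
    apply (TensorProduct.AlgebraTensorModule.cancelBaseChange R (R ⧸ p.asIdeal) (R ⧸ p.asIdeal)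
      p.asIdeal.ResidueField M).injective
    rw [map_zero, TensorProduct.mk_apply, TensorProduct.AlgebraTensorModule.cancelBaseChange_tmul,
      one_smul]
    exact hm
  obtain ⟨⟨c, hc⟩, h2⟩ := (IsLocalizedModule.eq_zero_iff (nonZeroDivisors (R ⧸ p.asIdeal)) _).1 h1
  obtain ⟨s, rfl⟩ := Ideal.Quotient.mk_surjective c
  refine ⟨s, fun hs => nonZeroDivisors.ne_zero hc (Ideal.Quotient.eq_zero_iff_mem.2 hs), ?_⟩
  have h3 := congrArg (TensorProduct.quotTensorEquivQuotSMul M p.asIdeal) h2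
  rw [Submonoid.mk_smul, map_zero, TensorProduct.smul_tmul', smul_eq_mul, mul_one,
    TensorProduct.quotTensorEquivQuotSMul_mk_tmul] at h3
  exact (Submodule.Quotient.mk_eq_zero _).1 h3

/-- A section of `A^(M) → M` induces one of `A_{k(p)}^(M) → M_{k(p)}`. -/
theorem ModuleFibre.projective_of_projective (hM : Module.Projective A M) :
    Module.Projective (p.asIdeal.Fiber A) (ModuleFibre R A M p) := by
  classical
  obtain ⟨s, hs⟩ := Module.projective_def'.1 hM
  let φ : p.asIdeal.ResidueField ⊗[R] M →ₗ[R] (M →₀ p.asIdeal.Fiber A) :=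
    (TensorProduct.finsuppRight R R p.asIdeal.ResidueField A M).toLinearMap ∘ₗ
      (s.restrictScalars R).lTensor p.asIdeal.ResidueField
  have hφ (c : p.asIdeal.ResidueField) (m x : M) : φ (c ⊗ₜ m) x = c ⊗ₜ (s m x) := by
    simp [φ, TensorProduct.finsuppRight_apply_tmul_apply]
  let σ : ModuleFibre R A M p →ₗ[p.asIdeal.Fiber A] (M →₀ p.asIdeal.Fiber A) :=
    ModuleFibre.lift φ.toAddMonoidHom (fun c d a m => by
      ext x
      simp only [LinearMap.toAddMonoidHom_coe, hφ, Finsupp.smul_apply]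
      simp [Algebra.TensorProduct.tmul_mul_tmul])
  refine Module.Projective.of_split σ
    (Finsupp.linearCombination _ fun x => ModuleFibre.mk A p 1 x) (ModuleFibre.hom_ext fun m => ?_)
  have h1 : σ (ModuleFibre.mk A p 1 m) =
      (s m).mapRange (fun a => (1 ⊗ₜ[R] a : p.asIdeal.Fiber A)) (TensorProduct.tmul_zero _ _) := by
    ext x
    exact hφ 1 m x
  have hm : (s m).sum (fun x a => a • x) = m := congr($hs m)
  rw [LinearMap.comp_apply, h1, Finsupp.linearCombination_apply,
    Finsupp.sum_mapRange_index (by simp)]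
  simp only [ModuleFibre.smul_mk, one_mul, LinearMap.id_apply]
  conv_rhs => rw [← hm]
  rw [Finsupp.sum, Finsupp.sum, ModuleFibre.mk_sum]

theorem algebraMap_residueField_ne_zero {s : R} (hs : s ∉ p.asIdeal) :
    algebraMap R p.asIdeal.ResidueField s ≠ 0 :=
  fun h => hs (Ideal.algebraMap_residueField_eq_zero.1 h)

theorem ModuleFibre.exists_eq_mk_inv (t : ModuleFibre R A M p) :
    ∃ s ∉ p.asIdeal, ∃ m : M, t = ModuleFibre.mk A p (algebraMap R _ s)⁻¹ m := by
  obtain ⟨s, hs, m, h⟩ := ModuleFibre.exists_smul_eq_mk t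
  refine ⟨s, hs, m, ?_⟩
  -- undo the multiplication by the unit `s`
  have h1 := congrArg ((((algebraMap R p.asIdeal.ResidueField s)⁻¹ ⊗ₜ[R] (1 : A) :
    p.asIdeal.Fiber A)) • ·) h
  simp only [ModuleFibre.smul_mk, ← mul_smul, Algebra.TensorProduct.tmul_mul_tmul, mul_one,
    inv_mul_cancel₀ (algebraMap_residueField_ne_zero hs), one_smul] at h1
  rw [← h1]
  exact (one_smul _ t).symm

/-- The fibre of `A` as a module is the fibre of `A` as an algebra. -/
def ModuleFibre.self (R A : Type*) [CommRing R] [Ring A] [Algebra R A] (p : PrimeSpectrum R) :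
    ModuleFibre R A A p ≃ₗ[p.asIdeal.Fiber A] p.asIdeal.Fiber A :=
  LinearEquiv.ofBijective (ModuleFibre.lift (AddMonoidHom.id _) (fun c d a m => by simp))
    Function.bijective_id

theorem fibre_exists_eq_inv_tmul (t : p.asIdeal.Fiber A) :
    ∃ s ∉ p.asIdeal, ∃ a : A, t = (algebraMap R _ s)⁻¹ ⊗ₜ a :=
  ModuleFibre.exists_eq_mk_inv (M := A) (A := A) t

theorem ModuleFibre.mk_eq_mk_div {s : R} (hs : s ∉ p.asIdeal) (c : p.asIdeal.ResidueField)
    (m : M) : ModuleFibre.mk A p c m =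
      ModuleFibre.mk A p (c * (algebraMap R p.asIdeal.ResidueField s)⁻¹) (s • m) := by
  rw [ModuleFibre.mk_smul, Algebra.smul_def, mul_left_comm,
    mul_inv_cancel₀ (algebraMap_residueField_ne_zero hs), mul_one]

/-- Flatness passes to fibres. After clearing denominators, a relation over `k(p) ⊗[R] A` becomes a
relation `∑ i, a i • m' i ∈ p M` in `M`, which is a relation in `M` with additional coefficients in
`p`. Those coefficients vanish in the fibre. -/
theorem EquationallyFlat.fibre (h : EquationallyFlat A M) (p : PrimeSpectrum R) :
    EquationallyFlat (p.asIdeal.Fiber A) (ModuleFibre R A M p) := by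
  classical
  intro n α μ h0
  choose s hs a hα using fun i => fibre_exists_eq_inv_tmul (α i)
  choose t ht m hμ using fun i => ModuleFibre.exists_eq_mk_inv (μ i)
  let κ := algebraMap R p.asIdeal.ResidueField
  -- a common denominator for all `α i` and `μ i`
  let w := ∏ i, s i * t i
  have hw : w ∉ p.asIdeal := by
    simp only [w, p.isPrime.prod_mem_iff, not_exists, not_and]
    exact fun i _ h => (p.isPrime.mem_or_mem h).elim (hs i) (ht i)
  have hdvd : ∀ i, ∃ v, w = s i * t i * v := fun i =>
    Finset.dvd_prod_of_mem (fun i => s i * t i) (Finset.mem_univ i)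
  choose v hv using hdvd
  have hv' : ∀ i, v i ∉ p.asIdeal := fun i h => hw (hv i ▸ p.asIdeal.mul_mem_left _ h)
  have h1 : ModuleFibre.mk A p (κ w)⁻¹ (∑ i, a i • v i • m i) = 0 := by
    rw [ModuleFibre.mk_sum, ← h0]
    refine Finset.sum_congr rfl fun i _ => ?_
    rw [hα, hμ, ModuleFibre.smul_mk, ModuleFibre.mk_eq_mk_div (hv' i) (_ * _), hv i,
      smul_comm (v i)]
    simp only [κ, map_mul, mul_inv]
  have h2 : ModuleFibre.mk A p 1 (∑ i, a i • v i • m i) = 0 := by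
    have := congrArg ((κ w ⊗ₜ[R] (1 : A) : p.asIdeal.Fiber A) • ·) h1
    simpa only [ModuleFibre.smul_mk, one_smul, smul_zero, κ,
      mul_inv_cancel₀ (algebraMap_residueField_ne_zero hw)] using this
  obtain ⟨s', hs', h3⟩ := ModuleFibre.exists_smul_mem_of_mk_eq_zero h2
  rw [← Submodule.span_univ, ← Set.range_id, Submodule.mem_ideal_smul_span_iff_exists_sum] at h3
  obtain ⟨c, hc, hsum⟩ := h3
  -- the relation `∑ i, a i • (s' v i m i) - ∑ l, c l • l = 0` in `M`, with `c l ∈ p`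
  obtain ⟨k, b, y, hy, hb⟩ := h.exists_of_fintype (ι := Fin n ⊕ c.support)
    (Sum.elim a fun l => - algebraMap R A (c l)) (Sum.elim (fun i => s' • v i • m i) fun l => l)
    (by
      simp only [Fintype.sum_sum_type, Sum.elim_inl, Sum.elim_inr, neg_smul, algebraMap_smul,
        Finset.sum_neg_distrib]
      rw [Finset.sum_coe_sort c.support (fun l => c l • l), ← sub_eq_add_neg, sub_eq_zero]
      rw [Finsupp.sum] at hsum
      simp only [id] at hsum
      rw [hsum, Finset.smul_sum]
      exact Finset.sum_congr rfl fun i _ => smul_comm _ _ _)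
  simp only [Fintype.sum_sum_type, Sum.elim_inl, Sum.elim_inr] at hb
  refine ⟨k, fun i j => (κ (t i * v i * s'))⁻¹ ⊗ₜ b (Sum.inl i) j,
    fun j => ModuleFibre.mk A p 1 (y j), fun i => ?_, fun j => ?_⟩
  · have := hy (Sum.inl i)
    simp only [Sum.elim_inl] at this
    simp only [ModuleFibre.smul_mk, mul_one]
    rw [← ModuleFibre.mk_sum, ← this, hμ, ModuleFibre.mk_eq_mk_div (hv' i),
      ModuleFibre.mk_eq_mk_div hs']
    simp only [κ, map_mul, mul_inv]
  · have e : ∀ i, α i * ((κ (t i * v i * s'))⁻¹ ⊗ₜ b (Sum.inl i) j) =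
        (κ (w * s'))⁻¹ ⊗ₜ (a i * b (Sum.inl i) j) := by
      intro i
      rw [hα, Algebra.TensorProduct.tmul_mul_tmul, hv i]
      congr 1
      simp only [κ, map_mul, mul_inv]
      ring
    simp_rw [e]
    rw [← TensorProduct.tmul_sum]
    refine ModuleFibre.mk_eq_zero_of_mem (A := A) (M := A) _ ?_
    rw [eq_neg_of_add_eq_zero_left (hb j), ← Finset.sum_neg_distrib]
    refine Submodule.sum_mem _ fun l _ => ?_
    rw [neg_mul, neg_neg, ← Algebra.smul_def]
    exact Submodule.smul_mem_smul (hc _) trivial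

end Fibre

/-! ### Self-injectivity of the fibres of a Frobenius algebra -/

section Baer

variable {R : Type*} {A : Type*} [CommRing R] [Ring A] [Algebra R A]

/-- Let `B` be an algebra over a field `K`. If `w ↦ (b ↦ ε (b w))` identifies `W` with the `K`-dual
of `B`, then `W` is an injective `B`-module: to extend a map `g` from a left ideal `J`, extend the
functional `ε ∘ g` from `J` to `B` and take the element of `W` that represents it. -/
theorem baer_of_bijective_pairing {K B W : Type*} [Field K] [Ring B] [Algebra K B] [AddCommGroup W]
    [Module B W] (ε : W →+ K) (hε : ∀ (c : K) (w : W), ε (algebraMap K B c • w) = c * ε w)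
    (hinj : ∀ w, (∀ b : B, ε (b • w) = 0) → w = 0)
    (hsurj : ∀ f : B →ₗ[K] K, ∃ w, ∀ b : B, ε (b • w) = f b) : Module.Baer B W := by
  intro J g
  let g' : J.restrictScalars K →ₗ[K] K :=
    { toFun := fun x => ε (g ⟨x, x.2⟩)
      map_add' := fun x y => by
        rw [← map_add, ← map_add]; rfl
      map_smul' := fun c x => by
        rw [RingHom.id_apply, smul_eq_mul, ← hε, ← map_smul]
        congr 2
        ext
        exact Algebra.smul_def _ _ }
  obtain ⟨f, hf⟩ := LinearMap.exists_extend g'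
  obtain ⟨w, hw⟩ := hsurj f
  refine ⟨LinearMap.toSpanSingleton B W w, fun x hx => ?_⟩
  rw [LinearMap.toSpanSingleton_apply, ← sub_eq_zero]
  refine hinj _ fun b => ?_
  have hbx : b * x ∈ J := J.mul_mem_left b hx
  have h1 : f (b * x) = ε (g ⟨b * x, hbx⟩) := congr($hf ⟨b * x, hbx⟩)
  have h2 : b • g ⟨x, hx⟩ = g ⟨b * x, hbx⟩ := by rw [← map_smul]; rfl
  rw [smul_sub, map_sub, h2, ← h1, ← mul_smul, hw, sub_self]

/-- Direct summands of finite direct sums of copies of an injective module are injective. -/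
theorem Module.Baer.of_sum_comp_eq_id {B X W : Type*} [Ring B] [AddCommGroup X] [Module B X]
    [AddCommGroup W] [Module B W] (hW : Module.Baer B W) {n : ℕ} (i : Fin n → X →ₗ[B] W)
    (r : Fin n → W →ₗ[B] X) (h : ∀ x, ∑ j, r j (i j x) = x) : Module.Baer B X := by
  intro J g
  choose g' hg' using fun j => hW J (i j ∘ₗ g)
  refine ⟨∑ j, r j ∘ₗ g' j, fun x hx => ?_⟩
  rw [← h (g ⟨x, hx⟩)]
  simp [LinearMap.sum_apply, hg' _ x hx]

/-- The pointwise `R`-module structure on `ω = Hom_R(A, R)`. -/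
instance DualisingModule.instModuleBase (R A : Type*) [CommRing R] [Ring A] [Algebra R A] :
    Module R (DualisingModule R A) :=
  inferInstanceAs (Module R (A →ₗ[R] R))

instance DualisingModule.instIsScalarTower (R A : Type*) [CommRing R] [Ring A] [Algebra R A] :
    IsScalarTower R A (DualisingModule R A) where
  smul_assoc r a φ := LinearMap.ext fun x => by
    refine (congrArg (show A →ₗ[R] R from φ) (mul_smul_comm r x a)).trans ?_
    exact (show A →ₗ[R] R from φ).map_smul r (x * a)

theorem exists_dual_basis (R A : Type*) [CommRing R] [AddCommGroup A] [Module R A]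
    [Module.Finite R A] [Module.Projective R A] :
    ∃ (n : ℕ) (a : Fin n → A) (f : Fin n → A →ₗ[R] R), ∀ x, ∑ t, f t x • a t = x := by
  obtain ⟨n, r, i, _, _, h⟩ := Module.Finite.exists_comp_eq_id_of_projective R A
  refine ⟨n, fun t => r (Pi.single t 1), fun t => LinearMap.proj t ∘ₗ i, fun x => ?_⟩
  refine Eq.trans ?_ (congr($h x))
  exact (apply_eq_sum_smul_single r (i x)).symm

/-- The fibre `k(p) ⊗[R] ω` is the `k(p)`-dual of the finite-dimensional algebra `k(p) ⊗[R] A`,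
hence injective. The pairing comes from evaluation at `1`; a dual basis of `A` over `R` shows that
it is bijective. -/
theorem DualisingModule.baer_fibre [Module.Finite R A] [Module.Projective R A]
    (p : PrimeSpectrum R) :
    Module.Baer (p.asIdeal.Fiber A) (ModuleFibre R A (DualisingModule R A) p) := by
  obtain ⟨n, a, f, haf⟩ := exists_dual_basis R A
  let κ := p.asIdeal.ResidueField
  let ev : κ ⊗[R] DualisingModule R A →ₗ[R] κ := (TensorProduct.rid R κ).toLinearMap ∘ₗ
    LinearMap.lTensor κ
      (show DualisingModule R A →ₗ[R] R from
        (LinearMap.applyₗ (1 : A) : (A →ₗ[R] R) →ₗ[R] R))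
  have hev : ∀ (c : κ) (φ : A →ₗ[R] R), ev (c ⊗ₜ[R] (show DualisingModule R A from φ)) =
      φ 1 • c := by
    intro c φ
    exact TensorProduct.rid_tmul c (φ 1)
  let ε : ModuleFibre R A (DualisingModule R A) p →+ κ := ev.toAddMonoidHom
  have hε : ∀ (c : κ) (φ : A →ₗ[R] R),
      ε (ModuleFibre.mk A p c (show DualisingModule R A from φ)) = φ 1 • c := hev
  have hε' : ∀ (d : κ) (x : A) (c : κ) (φ : A →ₗ[R] R), ε ((d ⊗ₜ[R] x : p.asIdeal.Fiber A) •
      (ModuleFibre.mk A p c (show DualisingModule R A from φ))) = φ x • (d * c) := by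
    intro d x c φ
    rw [ModuleFibre.smul_mk]
    refine (hε _ (x • (show DualisingModule R A from φ) : DualisingModule R A)).trans ?_
    congr 1
    exact (DualisingModule.smul_apply R A x φ 1).trans (by rw [one_mul])
  -- expansion in the dual basis; the coefficients of `w` are values of the pairing
  have hrec : ∀ w, w = ∑ t, ModuleFibre.mk A p
      (ε ((1 ⊗ₜ[R] a t : p.asIdeal.Fiber A) • w)) (show DualisingModule R A from f t) := by
    intro w
    induction w using ModuleFibre.induction with
    | zero =>
      refine (Finset.sum_eq_zero fun t _ => ?_).symm
      rw [smul_zero, map_zero]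
      exact TensorProduct.zero_tmul _ _
    | add w w' h h' =>
      conv_lhs => rw [h, h']
      rw [← Finset.sum_add_distrib]
      refine Finset.sum_congr rfl fun t _ => ?_
      rw [smul_add, map_add]
      exact (TensorProduct.add_tmul _ _ _).symm
    | mk c φ =>
      have hφ : φ = ∑ t, (show A →ₗ[R] R from φ) (a t) • (show DualisingModule R A from f t) := by
        refine LinearMap.ext fun x => ?_
        conv_lhs => rw [← haf x]
        refine (map_sum (show A →ₗ[R] R from φ) _ _).trans ?_
        refine Eq.trans ?_ (LinearMap.sum_apply _ _ _).symm
        refine Finset.sum_congr rfl fun t _ => ?_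
        refine ((show A →ₗ[R] R from φ).map_smul (f t x) (a t)).trans ?_
        exact mul_comm _ _
      conv_lhs => rw [hφ, ModuleFibre.mk_sum]
      refine Finset.sum_congr rfl fun t _ => ?_
      rw [ModuleFibre.mk_smul]
      congr 1
      exact ((hε' 1 (a t) c φ).trans (by rw [one_mul])).symm
  refine baer_of_bijective_pairing (K := κ) ε ?_ ?_ ?_
  · intro c w
    induction w using ModuleFibre.induction with
    | zero => simp
    | add w w' h h' => rw [smul_add, map_add, h, h', map_add, mul_add]
    | mk d φ =>
      refine (hε' c 1 d φ).trans ?_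
      rw [hε d φ, mul_smul_comm]
  · intro w hw
    rw [hrec w]
    refine Finset.sum_eq_zero fun t _ => ?_
    rw [hw]
    exact TensorProduct.zero_tmul _ _
  · intro l
    refine ⟨∑ t, ModuleFibre.mk A p (l (1 ⊗ₜ[R] a t)) (show DualisingModule R A from f t),
      fun b => ?_⟩
    induction b using TensorProduct.induction_on with
    | zero => simp
    | add b b' h h' => rw [add_smul, map_add, h, h', map_add]
    | tmul d x =>
      rw [Finset.smul_sum, map_sum]
      have h1 : l (d ⊗ₜ[R] x) = ∑ t, f t x • (d * l (1 ⊗ₜ[R] a t)) := by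
        conv_lhs => rw [← haf x]
        rw [TensorProduct.tmul_sum, map_sum]
        refine Finset.sum_congr rfl fun t _ => ?_
        have h2 (e : κ) : l (e ⊗ₜ[R] a t) = e * l (1 ⊗ₜ[R] a t) := by
          simpa [TensorProduct.smul_tmul'] using l.map_smul e (1 ⊗ₜ[R] a t)
        rw [TensorProduct.tmul_smul, TensorProduct.smul_tmul', h2, smul_mul_assoc]
      rw [h1]
      exact Finset.sum_congr rfl fun t _ => hε' d x _ (f t)

/-- The fibres of a Frobenius algebra are self-injective, since `A` belongs to `add ω`. -/
theorem IsFrobeniusAlgebra.baer_fibre (hA : IsFrobeniusAlgebra R A) (p : PrimeSpectrum R) :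
    Module.Baer (p.asIdeal.Fiber A) (p.asIdeal.Fiber A) := by
  have := hA.finite
  have := hA.projective
  -- `add_eq` quantifies over modules in a universe that need not contain `A`
  obtain ⟨n, i, r, hir⟩ := (hA.add_eq (ULift A)).2
    ⟨1, LinearMap.pi fun _ => ULift.moduleEquiv.toLinearMap,
      ULift.moduleEquiv.symm.toLinearMap ∘ₗ LinearMap.proj 0, LinearMap.ext fun _ => rfl⟩
  let i' : Fin n → A →ₗ[A] DualisingModule R A := fun j =>
    LinearMap.proj j ∘ₗ i ∘ₗ ULift.moduleEquiv.symm.toLinearMap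
  let r' : Fin n → DualisingModule R A →ₗ[A] A := fun j =>
    ULift.moduleEquiv.toLinearMap ∘ₗ r ∘ₗ LinearMap.single A (fun _ => DualisingModule R A) j
  have h : ∀ x, ∑ j, r' j (i' j x) = x := by
    intro x
    have h1 := congrArg ULift.down (congr($hir (ULift.up x)))
    refine Eq.trans ?_ h1
    refine (map_sum (ULift.moduleEquiv.toLinearMap ∘ₗ r)
      (fun j => Pi.single j (i (ULift.up x) j)) Finset.univ).symm.trans ?_
    rw [Finset.univ_sum_single]
    rfl
  refine Module.Baer.of_equiv (ModuleFibre.self R A p)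
    ((DualisingModule.baer_fibre p).of_sum_comp_eq_id (fun j => ModuleFibre.map p (i' j))
      (fun j => ModuleFibre.map p (r' j)) fun x => ?_)
  induction x using ModuleFibre.induction with
  | zero => simp
  | add x y hx hy => simp only [map_add, Finset.sum_add_distrib, hx, hy]
  | mk c x =>
    simp only [ModuleFibre.map_mk]
    rw [← ModuleFibre.mk_sum, h]

end Baer

/-! ### Modules with projective fibres -/

section FibrewiseProjective

variable {R : Type*} {A : Type*} [CommRing R] [Ring A] [Algebra R A]
  {M : Type*} [AddCommGroup M] [Module R M] [Module A M] [IsScalarTower R A M]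
  {N : Type*} [AddCommGroup N] [Module R N] [Module A N] [IsScalarTower R A N]
  {L : Type*} [AddCommGroup L] [Module R L] [Module A L] [IsScalarTower R A L]

/-- All fibres `k(p) ⊗[R] M` are projective over the fibres of `A`. -/
def FibrewiseProjective (R A M : Type*) [CommRing R] [Ring A] [Algebra R A]
    [AddCommGroup M] [Module R M] [Module A M] [IsScalarTower R A M] : Prop :=
  ∀ p : PrimeSpectrum R, Module.Projective (p.asIdeal.Fiber A) (ModuleFibre R A M p)

theorem FibrewiseProjective.of_projective (h : Module.Projective A M) :
    FibrewiseProjective R A M := fun _ => ModuleFibre.projective_of_projective h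

theorem FibrewiseProjective.of_split (h : FibrewiseProjective R A N) (i : M →ₗ[A] N)
    (r : N →ₗ[A] M) (hir : r ∘ₗ i = LinearMap.id) : FibrewiseProjective R A M := fun p => by
  have := h p
  refine Module.Projective.of_split (ModuleFibre.map p i) (ModuleFibre.map p r) ?_
  rw [← ModuleFibre.map_comp, hir, ModuleFibre.map_id]

theorem FibrewiseProjective.of_equiv (h : FibrewiseProjective R A N) (e : M ≃ₗ[A] N) :
    FibrewiseProjective R A M :=
  h.of_split e.toLinearMap e.symm.toLinearMap (by ext; simp)

/-- A short exact sequence of `A`-modules whose right-hand term is projective over `R` splits over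
`R`. -/
theorem exists_base_retraction {f : M →ₗ[A] N} {g : N →ₗ[A] L} (hf : Function.Injective f)
    (hfg : Function.Exact f g) (hg : Function.Surjective g) (hL : Module.Projective R L) :
    ∃ ρ : N →ₗ[R] M, ∀ m, ρ (f m) = m := by
  obtain ⟨r, hr⟩ := exists_retraction_of_projective_right (f := f.restrictScalars R)
    (g := g.restrictScalars R) hf hfg hg
  exact ⟨r, fun m => congr($hr m)⟩

theorem Submodule.exists_base_retraction (K : Submodule A N) (h : Module.Projective R (N ⧸ K)) :
    ∃ ρ : N →ₗ[R] K, ∀ m : K, ρ m = m :=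
  _root_.exists_base_retraction (f := K.subtype) (g := K.mkQ) K.subtype_injective
    (LinearMap.exact_subtype_mkQ K) K.mkQ_surjective h

theorem projective_finsupp {B P : Type*} [Ring B] [AddCommGroup P] [Module B P]
    (h : Module.Projective B P) (ι : Type*) : Module.Projective B (ι →₀ P) := by
  classical
  exact Module.Projective.of_equiv (finsuppLequivDFinsupp B).symm

theorem FibrewiseProjective.quotient_ker {π : N →ₗ[A] M} (hπ : Function.Surjective π)
    (h : FibrewiseProjective R A M) : FibrewiseProjective R A (N ⧸ LinearMap.ker π) :=
  h.of_equiv (π.quotKerEquivOfSurjective hπ)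

theorem projective_quotient_ker {π : N →ₗ[A] M} (hπ : Function.Surjective π)
    (h : Module.Projective R M) : Module.Projective R (N ⧸ LinearMap.ker π) :=
  Module.Projective.of_equiv ((π.quotKerEquivOfSurjective hπ).restrictScalars R).symm

theorem FibrewiseProjective.left {f : M →ₗ[A] N} {g : N →ₗ[A] L} (hf : Function.Injective f)
    (hfg : Function.Exact f g) (hg : Function.Surjective g) (hL : Module.Projective R L)
    (hN' : FibrewiseProjective R A N) (hL' : FibrewiseProjective R A L) :
    FibrewiseProjective R A M := fun p => by
  obtain ⟨ρ, hρ⟩ := exists_base_retraction hf hfg hg hL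
  have := hN' p
  have := hL' p
  exact projective_left_of_exact (ModuleFibre.map_injective hρ) (ModuleFibre.map_exact hfg hg)
    (ModuleFibre.map_surjective hg)

/-- In a short exact sequence of `A`-modules that splits over `R`, if the middle term has projective
fibres and the left-hand term has injective ones, then the right-hand term has projective fibres:
the sequence of fibres splits. -/
theorem FibrewiseProjective.right {f : M →ₗ[A] N} {g : N →ₗ[A] L}
    (hfg : Function.Exact f g) (hg : Function.Surjective g) {ρ : N →ₗ[R] M}
    (hρ : ∀ m, ρ (f m) = m) (hN : FibrewiseProjective R A N)
    (hM : ∀ p : PrimeSpectrum R, Module.Baer (p.asIdeal.Fiber A) (ModuleFibre R A M p)) :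
    FibrewiseProjective R A L := fun p => by
  have := hN p
  obtain ⟨r, hr⟩ := (hM p).exists_retraction _ (ModuleFibre.map_injective (p := p) hρ)
  exact projective_right_of_retraction (ModuleFibre.map_exact hfg hg)
    (ModuleFibre.map_surjective hg) hr

/-- Let `K` be a submodule of a free module `N`. If `N ⧸ K` is projective over `R` and has
projective fibre at `p`, a retraction of `N_{k(p)}` onto `K_{k(p)}` lifts, up to a denominator `s ∉
p`, to an `A`-linear map `θ : N → K` which on a given element `x` of `K` agrees with multiplication
by `s` modulo `p K`. -/
theorem FibrewiseProjective.exists_approx_retraction {ι : Type*} (b : Module.Basis ι A N)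
    {K : Submodule A N}
    (hR : Module.Projective R (N ⧸ K)) (h : FibrewiseProjective R A (N ⧸ K))
    (p : PrimeSpectrum R) (x : K) :
    ∃ s ∉ p.asIdeal, ∃ θ : N →ₗ[A] K, θ x - s • x ∈ p.asIdeal • (⊤ : Submodule R K) := by
  classical
  have hex : Function.Exact K.subtype K.mkQ := LinearMap.exact_subtype_mkQ K
  obtain ⟨ρ, hρ⟩ := K.exists_base_retraction hR
  have := h p
  -- the fibre of the quotient splits off; `id - σ ∘ mkQ` is the retraction onto the fibre of `K`,
  -- and `t j` is its value at the basis vector `b j`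
  obtain ⟨σ, hσ⟩ := Module.projective_lifting_property (ModuleFibre.map p K.mkQ) LinearMap.id
    (ModuleFibre.map_surjective K.mkQ_surjective)
  have hu : ∀ j : ι, ∃ t : ModuleFibre R A K p, ModuleFibre.map p K.subtype t =
      ModuleFibre.mk A p 1 (b j) -
        σ (ModuleFibre.map p K.mkQ (ModuleFibre.mk A p 1 (b j))) := by
    intro j
    refine (ModuleFibre.map_exact hex K.mkQ_surjective _).1 ?_
    rw [map_sub, ← LinearMap.comp_apply, hσ, LinearMap.id_apply, sub_self]
  choose t ht using hu
  choose s hs y hy using fun j => ModuleFibre.exists_eq_mk_inv (t j)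
  -- only the denominators of the basis vectors that occur in `x` need to be cleared
  let S := (b.repr x).support
  let w : ι → R := fun j => ∏ i ∈ S.erase j, s i
  let θ : N →ₗ[A] K := b.constr ℕ fun j => w j • y j
  have hS : ∏ i ∈ S, s i ∉ p.asIdeal := by
    simp only [p.isPrime.prod_mem_iff, not_exists, not_and]
    exact fun i _ => hs i
  have hw : ∀ j, w j ∉ p.asIdeal := by
    intro j
    simp only [w, p.isPrime.prod_mem_iff, not_exists, not_and]
    exact fun i _ => hs i
  let u : p.asIdeal.Fiber A := algebraMap R p.asIdeal.ResidueField (∏ i ∈ S, s i) ⊗ₜ 1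
  have hθ : ∀ j ∈ S, ModuleFibre.mk A p 1 (w j • y j) = u • t j := by
    intro j hj
    rw [hy, ModuleFibre.smul_mk, one_smul, ModuleFibre.mk_eq_mk_div (hw j) (_ * _)]
    congr 1
    have h1 := algebraMap_residueField_ne_zero (hs j)
    have h2 := algebraMap_residueField_ne_zero (hw j)
    rw [← Finset.mul_prod_erase S s hj, map_mul]
    field_simp
    rfl
  have h0 : ModuleFibre.mk A p 1 (θ x - (∏ i ∈ S, s i) • x) = 0 := by
    apply ModuleFibre.map_injective (p := p) (f := K.subtype) hρ
    rw [map_zero]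
    have hx : (x : N) = ∑ j ∈ S, b.repr x j • b j := by
      conv_lhs => rw [← b.linearCombination_repr (x : N)]
      rw [Finsupp.linearCombination_apply, Finsupp.sum]
    have h1 : ModuleFibre.mk A p 1 (θ x) =
        u • ∑ j ∈ S, (1 ⊗ₜ b.repr x j : p.asIdeal.Fiber A) • t j := by
      rw [b.constr_apply, Finsupp.sum, ModuleFibre.mk_sum, Finset.smul_sum]
      refine Finset.sum_congr rfl fun j hj => ?_
      have h2 : ModuleFibre.mk A p 1 (b.repr x j • w j • y j) =
          (1 ⊗ₜ b.repr x j : p.asIdeal.Fiber A) • ModuleFibre.mk A p 1 (w j • y j) := by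
        rw [ModuleFibre.smul_mk, one_mul]
      rw [h2, hθ j hj, ← mul_smul, ← mul_smul]
      simp [u, Algebra.TensorProduct.tmul_mul_tmul]
    have h3 : ModuleFibre.map p K.subtype
        (∑ j ∈ S, (1 ⊗ₜ b.repr x j : p.asIdeal.Fiber A) • t j) =
        ModuleFibre.mk A p 1 (x : N) := by
      have h4 : ModuleFibre.mk A p 1 (x : N) = ∑ j ∈ S,
          (1 ⊗ₜ b.repr x j : p.asIdeal.Fiber A) •
            ModuleFibre.mk A p 1 (b j) := by
        conv_lhs => rw [hx]
        rw [ModuleFibre.mk_sum]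
        refine Finset.sum_congr rfl fun j _ => ?_
        rw [ModuleFibre.smul_mk, one_mul]
      have h5 : σ (ModuleFibre.map p K.mkQ (ModuleFibre.mk A p 1 (x : N))) = 0 := by
        have h6 : K.mkQ (x : N) = 0 := (Submodule.Quotient.mk_eq_zero _).2 x.2
        rw [ModuleFibre.map_mk, h6, ← ModuleFibre.mkHom_apply, map_zero, map_zero]
      rw [h4, map_sum, map_sum] at h5
      rw [map_sum, ← sub_zero (ModuleFibre.mk A p 1 (x : N)), ← h5, h4,
        ← Finset.sum_sub_distrib]
      refine Finset.sum_congr rfl fun j _ => ?_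
      rw [map_smul, ht, smul_sub, map_smul, map_smul]
    have h7 : ModuleFibre.mk A p 1 ((∏ i ∈ S, s i) • x) = u • ModuleFibre.mk A p 1 x := by
      rw [ModuleFibre.smul_mk, one_smul, ModuleFibre.mk_smul, Algebra.smul_def]
    have h8 : ModuleFibre.mk A p 1 (θ x - (∏ i ∈ S, s i) • x) =
        ModuleFibre.mk A p 1 (θ x) - ModuleFibre.mk A p 1 ((∏ i ∈ S, s i) • x) :=
      map_sub (ModuleFibre.mkHom A p 1) _ _
    rw [h8, map_sub, h1, h7, map_smul, h3, map_smul, ModuleFibre.map_mk]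
    exact sub_self _
  obtain ⟨s', hs', h'⟩ := ModuleFibre.exists_smul_mem_of_mk_eq_zero h0
  refine ⟨s' * ∏ i ∈ S, s i, fun h => (p.isPrime.mem_or_mem h).elim hs' hS, s' • θ, ?_⟩
  have e : (s' • θ) x - (s' * ∏ i ∈ S, s i) • x = s' • (θ x - (∏ i ∈ S, s i) • x) := by
    rw [LinearMap.smul_apply, mul_smul]
    exact (smul_sub _ _ _).symm
  rw [e]
  exact h'

end FibrewiseProjective

/-! ### Products of a right ideal and a left module -/

section RightIdeal

variable {A : Type*} [Ring A] {M N : Type*} [AddCommGroup M] [Module A M]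
  [AddCommGroup N] [Module A N]

/-- The subgroup `J M` of a left `A`-module `M`, for a right ideal `J` of `A`. Right ideals are
`Aᵐᵒᵖ`-submodules of `A`. -/
def rightIdealSMul (J : Submodule Aᵐᵒᵖ A) (M : Type*) [AddCommGroup M] [Module A M] :
    AddSubgroup M :=
  AddSubgroup.closure {z | ∃ a ∈ J, ∃ m : M, z = a • m}

theorem smul_mem_rightIdealSMul {J : Submodule Aᵐᵒᵖ A} {a : A} (ha : a ∈ J) (m : M) :
    a • m ∈ rightIdealSMul J M :=
  AddSubgroup.subset_closure ⟨a, ha, m, rfl⟩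

theorem rightIdealSMul_le_iff {J : Submodule Aᵐᵒᵖ A} {T : AddSubgroup M} :
    rightIdealSMul J M ≤ T ↔ ∀ a ∈ J, ∀ m : M, a • m ∈ T := by
  refine (AddSubgroup.closure_le _).trans ⟨fun h a ha m => h ⟨a, ha, m, rfl⟩, ?_⟩
  rintro h _ ⟨a, ha, m, rfl⟩
  exact h a ha m

theorem rightIdealSMul_mono {J J' : Submodule Aᵐᵒᵖ A} (h : J ≤ J') :
    rightIdealSMul J M ≤ rightIdealSMul J' M :=
  rightIdealSMul_le_iff.2 fun _ ha m => smul_mem_rightIdealSMul (h ha) m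

theorem map_mem_rightIdealSMul {J : Submodule Aᵐᵒᵖ A} (f : M →ₗ[A] N) {z : M}
    (hz : z ∈ rightIdealSMul J M) : f z ∈ rightIdealSMul J N := by
  have : rightIdealSMul J M ≤ (rightIdealSMul J N).comap f.toAddMonoidHom :=
    rightIdealSMul_le_iff.2 fun a ha m => by
      simpa using smul_mem_rightIdealSMul ha (f m)
  exact this hz

theorem exists_of_mem_rightIdealSMul {J : Submodule Aᵐᵒᵖ A} {f : M →ₗ[A] N}
    (hf : Function.Surjective f) {z : N} (hz : z ∈ rightIdealSMul J N) :
    ∃ y ∈ rightIdealSMul J M, f y = z := by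
  have : rightIdealSMul J N ≤ (rightIdealSMul J M).map f.toAddMonoidHom :=
    rightIdealSMul_le_iff.2 fun a ha n => by
      obtain ⟨m, rfl⟩ := hf n
      exact ⟨a • m, smul_mem_rightIdealSMul ha m, by simp⟩
  exact this hz

theorem mem_rightIdealSMul_iff_repr_mem {ι : Type*} (b : Module.Basis ι A M)
    {J : Submodule Aᵐᵒᵖ A} {z : M} :
    z ∈ rightIdealSMul J M ↔ ∀ i, b.repr z i ∈ J := by
  constructor
  · intro hz i
    have : rightIdealSMul J A ≤ J.toAddSubgroup :=
      rightIdealSMul_le_iff.2 fun a ha m => J.smul_mem (MulOpposite.op m) ha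
    exact this (map_mem_rightIdealSMul (b.coord i) hz)
  · intro h
    rw [← b.linearCombination_repr z, Finsupp.linearCombination_apply]
    exact AddSubgroup.sum_mem _ fun i _ => smul_mem_rightIdealSMul (h i) (b i)

theorem exists_sum_of_mem_rightIdealSMul_span {n : ℕ} (a : Fin n → A) {z : M}
    (hz : z ∈ rightIdealSMul (Submodule.span Aᵐᵒᵖ (Set.range a)) M) :
    ∃ m : Fin n → M, z = ∑ i, a i • m i := by
  let φ : (Fin n → M) →+ M := AddMonoidHom.mk' (fun m => ∑ i, a i • m i) (fun m m' => by
    simp [Finset.sum_add_distrib])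
  have : rightIdealSMul (Submodule.span Aᵐᵒᵖ (Set.range a)) M ≤ φ.range :=
    rightIdealSMul_le_iff.2 fun b hb m => by
      obtain ⟨c, rfl⟩ := (Submodule.mem_span_range_iff_exists_fun _).1 hb
      refine ⟨fun i => (c i).unop • m, ?_⟩
      simp [φ, Finset.sum_smul, mul_smul]
  obtain ⟨m, hm⟩ := this hz
  exact ⟨m, hm.symm⟩

end RightIdeal

/-! ### Flatness of modules with projective fibres -/

section Devissage

universe u v w

variable {R : Type u} {A : Type v} [CommRing R] [Ring A] [Algebra R A]

/-- For `s ∈ R`, an element of `(J + s A) M` is the sum of an element of `J M` and a multiple `s y`.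
-/
theorem exists_of_mem_rightIdealSMul_sup {J : Submodule Aᵐᵒᵖ A} {s : R}
    {M : Type*} [AddCommGroup M] [Module R M] [Module A M] [IsScalarTower R A M] {z : M}
    (hz : z ∈ rightIdealSMul (J ⊔ Submodule.span Aᵐᵒᵖ {algebraMap R A s}) M) :
    ∃ x ∈ rightIdealSMul J M, ∃ y, z = x + s • y := by
  have : rightIdealSMul (J ⊔ Submodule.span Aᵐᵒᵖ {algebraMap R A s}) M ≤
      rightIdealSMul J M ⊔ (DistribSMul.toAddMonoidHom M s).range :=
    rightIdealSMul_le_iff.2 fun b hb m => by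
      obtain ⟨a, ha, c, hc, rfl⟩ := Submodule.mem_sup.1 hb
      obtain ⟨d, rfl⟩ := Submodule.mem_span_singleton.1 hc
      refine AddSubgroup.mem_sup.2 ⟨a • m, smul_mem_rightIdealSMul ha m, s • d.unop • m,
        ⟨d.unop • m, rfl⟩, ?_⟩
      rw [add_smul, MulOpposite.smul_eq_mul_unop, mul_smul, algebraMap_smul]
  obtain ⟨x, hx, _, ⟨y, rfl⟩, h⟩ := AddSubgroup.mem_sup.1 (this hz)
  exact ⟨x, hx, y, h.symm⟩

theorem smul_mem_rightIdeal (J : Submodule Aᵐᵒᵖ A) (r : R) {a : A} (ha : a ∈ J) : r • a ∈ J := by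
  have := J.smul_mem (MulOpposite.op (algebraMap R A r)) ha
  rwa [MulOpposite.smul_eq_mul_unop, MulOpposite.unop_op, ← Algebra.commutes,
    ← Algebra.smul_def] at this

/-- The right ideal `(J : s)` of all `a` with `s a ∈ J`, for `s ∈ R`. -/
def rightIdealColon (J : Submodule Aᵐᵒᵖ A) (s : R) : Submodule Aᵐᵒᵖ A where
  carrier := {a | s • a ∈ J}
  add_mem' ha hb := by simpa [smul_add] using J.add_mem ha hb
  zero_mem' := by simp
  smul_mem' c a ha := by
    have := J.smul_mem c ha
    simpa [MulOpposite.smul_eq_mul_unop] using this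

/-- The contraction `J ∩ R` of a right ideal `J` to the base ring, as an ideal of `R`. -/
def rightIdealContraction (R : Type*) {A : Type*} [CommRing R] [Ring A] [Algebra R A]
    (J : Submodule Aᵐᵒᵖ A) : Ideal R where
  carrier := {s | algebraMap R A s ∈ J}
  add_mem' ha hb := by simpa using J.add_mem ha hb
  zero_mem' := by simp
  smul_mem' c a ha := by
    simpa [Algebra.smul_def] using smul_mem_rightIdeal J c ha

/-- If `F` is free and `F ⧸ K` is projective over `R` with projective fibres, then `K ∩ J F = J K`
for every right ideal `J`. In other words, `Tor₁(A / J, F / K) = 0`.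

This is a noetherian induction on `J`, for all pairs `(F, K)` in a fixed universe at once. If `A /
J` has torsion, that is, `s a ∈ J` with `s ∈ R`, `s ∉ J` and `a ∉ J`, then the cases of `J + s A`
and `(J : s)` imply that of `J`. Otherwise `p = J ∩ R` is prime and `A / J` is torsion-free over `R
/ p`; then an approximate retraction at `p` shows `s x ∈ J K` for some `s ∉ p`, and the case of `J +
s A` for a presentation of `K` allows one to divide by `s`. -/
theorem inter_rightIdealSMul_le [IsNoetherianRing R] [Module.Finite R A]
    (hA : Module.Projective R A) (J : Submodule Aᵐᵒᵖ A) :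
    ∀ (F : Type (max v w)) [AddCommGroup F] [Module R F] [Module A F] [IsScalarTower R A F]
      [Module.Free A F] (K : Submodule A F), Module.Projective R (F ⧸ K) →
      FibrewiseProjective R A (F ⧸ K) →
      ∀ x : K, (x : F) ∈ rightIdealSMul J F → x ∈ rightIdealSMul J K := by
  have : IsNoetherian Aᵐᵒᵖ A := isNoetherian_of_tower R inferInstance
  induction J using WellFoundedGT.induction with
  | ind J ih =>
  intro F _ _ _ _ _ K hR hF x hx
  let b := Module.Free.chooseBasis A F
  by_cases h1 : (1 : A) ∈ J
  · simpa using smul_mem_rightIdealSMul h1 x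
  have hsup : ∀ s : R, algebraMap R A s ∉ J →
      J < J ⊔ Submodule.span Aᵐᵒᵖ {algebraMap R A s} := fun s hs =>
    lt_of_le_of_ne le_sup_left fun h => hs (h ▸ Submodule.mem_sup_right
      (Submodule.mem_span_singleton_self _))
  -- `hcase` says that `A / J` has torsion over the image of `R`
  by_cases hcase : ∃ s : R, algebraMap R A s ∉ J ∧ ∃ a ∉ J, s • a ∈ J
  · obtain ⟨s, hs, a, ha, hsa⟩ := hcase
    obtain ⟨x₁, hx₁, y, rfl⟩ := exists_of_mem_rightIdealSMul_sup
      (ih _ (hsup s hs) F K hR hF x (rightIdealSMul_mono le_sup_left hx))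
    have hlt : J < rightIdealColon J s :=
      lt_of_le_of_ne (fun b hb => smul_mem_rightIdeal J s hb) fun h => ha (h ▸ hsa)
    have hy : (y : F) ∈ rightIdealSMul (rightIdealColon J s) F := by
      have h2 : s • (y : F) ∈ rightIdealSMul J F := by
        have := sub_mem hx (map_mem_rightIdealSMul K.subtype hx₁)
        simpa using this
      rw [mem_rightIdealSMul_iff_repr_mem b] at h2 ⊢
      intro i
      have h3 : b.repr (s • (y : F)) i = s • b.repr y i :=
        LinearMap.map_smul_of_tower (b.coord i) s (y : F)
      have h4 := h2 i
      rwa [h3] at h4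
    have hy' := ih _ hlt F K hR hF y hy
    refine add_mem hx₁ ?_
    have hle : rightIdealSMul (rightIdealColon J s) K ≤
        (rightIdealSMul J K).comap (DistribSMul.toAddMonoidHom K s) :=
      rightIdealSMul_le_iff.2 fun b hb m => by
        have := smul_mem_rightIdealSMul (J := J) (a := s • b) hb m
        rwa [smul_assoc] at this
    exact hle hy'
  · push Not at hcase
    -- without torsion, the annihilator `J ∩ R` of `1 ∈ A / J` is prime
    have hp : (rightIdealContraction R J).IsPrime := by
      refine ⟨fun h => h1 ?_, fun {s t} hst => or_iff_not_imp_left.2 fun hs => ?_⟩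
      · have : (1 : R) ∈ rightIdealContraction R J := h ▸ trivial
        simpa [rightIdealContraction] using this
      · by_contra ht
        refine hcase s hs _ ht ?_
        have : algebraMap R A (s * t) ∈ J := hst
        rwa [map_mul, ← Algebra.smul_def] at this
    obtain ⟨s, hs, θ, hθ⟩ := hF.exists_approx_retraction b hR ⟨_, hp⟩ x
    have hs : algebraMap R A s ∉ J := hs
    have hpK : ∀ z ∈ rightIdealContraction R J • (⊤ : Submodule R K), z ∈ rightIdealSMul J K := by
      intro z hz
      induction hz using Submodule.smul_induction_on' with
      | smul r hr m _ =>
        have := smul_mem_rightIdealSMul (M := K) hr m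
        rwa [algebraMap_smul] at this
      | add y _ z _ hy hz => exact add_mem hy hz
    have hsx : s • x ∈ rightIdealSMul J K := by
      have := sub_mem (map_mem_rightIdealSMul θ hx) (hpK _ hθ)
      rwa [sub_sub_cancel] at this
    -- it remains to divide `s • x` by `s`: lift `x` to `f` and `s • x` to `g ∈ J A^(K)` in a free
    -- presentation of `K`; the kernel satisfies the hypotheses again, since `K` does as a syzygy
    let π : (K →₀ A) →ₗ[A] K := Finsupp.linearCombination A id
    have hπ : Function.Surjective π := Finsupp.linearCombination_id_surjective A K
    have hex : Function.Exact K.subtype K.mkQ := LinearMap.exact_subtype_mkQ K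
    have hfree : Module.Projective R F :=
      have := projective_finsupp hA (Module.Free.ChooseBasisIndex A F)
      Module.Projective.of_equiv (b.repr.restrictScalars R).symm
    have hKF : FibrewiseProjective R A K := FibrewiseProjective.left K.subtype_injective hex
      K.mkQ_surjective hR
      (FibrewiseProjective.of_projective (M := F) inferInstance) hF
    have hKR : Module.Projective R K := by
      obtain ⟨ρ, hρ⟩ := K.exists_base_retraction hR
      exact Module.Projective.of_split (K.subtype.restrictScalars R) ρ (LinearMap.ext hρ)
    let b' : Module.Basis K A (K →₀ A) := Finsupp.basisSingleOne
    obtain ⟨f, rfl⟩ := hπ x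
    obtain ⟨g, hg, hgx⟩ := exists_of_mem_rightIdealSMul hπ hsx
    have hx' : s • f - g ∈ LinearMap.ker π := by
      rw [LinearMap.mem_ker, map_sub, hgx, LinearMap.map_smul_of_tower, sub_self]
    have hR' := projective_quotient_ker (R := R) (N := K →₀ A) (M := K) hπ hKR
    have hF' := FibrewiseProjective.quotient_ker (R := R) (N := K →₀ A) (M := K) hπ hKF
    obtain ⟨x₁, hx₁, x₂, hx₂⟩ := exists_of_mem_rightIdealSMul_sup
      (ih _ (hsup s hs) (K →₀ A) (LinearMap.ker π) hR' hF' ⟨s • f - g, hx'⟩ (by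
          rw [mem_rightIdealSMul_iff_repr_mem b'] at hg ⊢
          intro i
          refine sub_mem (Submodule.mem_sup_right ?_) (Submodule.mem_sup_left (hg i))
          refine Submodule.mem_span_singleton.2 ⟨MulOpposite.op (f i), ?_⟩
          simp [Algebra.smul_def]))
    -- `f - x₂` is another lift of `x`, and it lies in `J A^(K)` as `A / J` is torsion-free
    have h2 : s • (f - x₂) ∈ rightIdealSMul J (K →₀ A) := by
      have h3 := add_mem hg (map_mem_rightIdealSMul (LinearMap.ker π).subtype hx₁)
      have h4 : s • f - g = x₁ + s • (x₂ : K →₀ A) := congrArg Subtype.val hx₂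
      convert h3 using 1
      rw [smul_sub, sub_eq_iff_eq_add, Submodule.subtype_apply, add_assoc, ← h4]
      abel
    have h3 : f - x₂ ∈ rightIdealSMul J (K →₀ A) := by
      rw [mem_rightIdealSMul_iff_repr_mem b'] at h2 ⊢
      intro i
      by_contra h
      exact hcase s hs _ h (h2 i)
    have h4 := map_mem_rightIdealSMul π h3
    rwa [map_sub, LinearMap.mem_ker.1 x₂.2, sub_zero] at h4

/-- A module that is projective over `R` and has projective fibres is flat. -/
theorem FibrewiseProjective.equationallyFlat [IsNoetherianRing R] [Module.Finite R A]
    (hA : Module.Projective R A) {M : Type w} [AddCommGroup M] [Module R M] [Module A M]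
    [IsScalarTower R A M] (hR : Module.Projective R M) (h : FibrewiseProjective R A M) :
    EquationallyFlat A M := by
  intro n a m h0
  -- the free module is lifted to the universe of the free modules in `inter_rightIdealSMul_le`
  let ι := ULift.{max v w} M
  let π : (ι →₀ A) →ₗ[A] M := Finsupp.linearCombination A ULift.down
  have hπ : Function.Surjective π := fun m => ⟨Finsupp.single ⟨m⟩ 1, by simp [π]⟩
  let f : Fin n → ι →₀ A := fun i => Finsupp.single ⟨m i⟩ 1
  have hf : ∀ i, π (f i) = m i := fun i => by simp [f, π]
  have hx : ∑ i, a i • f i ∈ LinearMap.ker π := by simp [hf, h0]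
  have hxJ : ∑ i, a i • f i ∈ rightIdealSMul (Submodule.span Aᵐᵒᵖ (Set.range a)) (ι →₀ A) :=
    sum_mem fun i _ => smul_mem_rightIdealSMul (Submodule.subset_span (Set.mem_range_self i)) (f i)
  have hx' := inter_rightIdealSMul_le hA (Submodule.span Aᵐᵒᵖ (Set.range a)) (ι →₀ A)
    (LinearMap.ker π) (projective_quotient_ker (R := R) (N := ι →₀ A) hπ hR)
    (h.quotient_ker (N := ι →₀ A) hπ) ⟨_, hx⟩ hxJ
  obtain ⟨k, hk⟩ := exists_sum_of_mem_rightIdealSMul_span a hx'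
  have hk' : ∑ i, a i • f i = ∑ i, a i • (k i : ι →₀ A) := by
    simpa using congrArg Subtype.val hk
  have hfree : EquationallyFlat A (ι →₀ A) :=
    (IsFlatModule.of_projective (A := A) (M := ι →₀ A) inferInstance).equationallyFlat
  -- correcting the lifts `f i` of `m i` by `k i ∈ ker π` turns the relation in `M` into one in a
  -- free module
  obtain ⟨l, b, y, hy, hb⟩ := hfree n a (fun i => f i - k i) (by
    simp [smul_sub, Finset.sum_sub_distrib, hk'])
  refine ⟨l, b, fun j => π (y j), fun i => ?_, hb⟩
  have := congrArg π (hy i)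
  rw [map_sub, hf, LinearMap.mem_ker.1 (k i).2, sub_zero, map_sum] at this
  simpa using this

end Devissage

/-! ### Countably generated flat modules -/

section Telescope

variable {A : Type*} [Ring A] {M : Type*} [AddCommGroup M] [Module A M]

/-- The `A`-module `M` is generated by a countable set. -/
def CountablyGenerated (A M : Type*) [Ring A] [AddCommGroup M] [Module A M] : Prop :=
  ∃ S : Set M, S.Countable ∧ Submodule.span A S = ⊤

theorem CountablyGenerated.of_surjective {N : Type*} [AddCommGroup N] [Module A N]
    (h : CountablyGenerated A M) (f : M →ₗ[A] N) (hf : Function.Surjective f) :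
    CountablyGenerated A N := by
  obtain ⟨S, hS, hspan⟩ := h
  refine ⟨f '' S, hS.image f, ?_⟩
  rw [Submodule.span_image, hspan, Submodule.map_top, LinearMap.range_eq_top.2 hf]

/-- A variant of `LocallyFactorsFree` in which all the finite free modules are replaced by the
single module `A^(ℕ)`, so that the factorizations of a chain of submodules have the same middle
term. The image in `M` is still finitely generated. -/
theorem LocallyFactorsFree.exists_factor_finsupp (h : LocallyFactorsFree A M)
    (F : Submodule A M) (hF : F.FG) :
    ∃ (α : F →ₗ[A] (ℕ →₀ A)) (β : (ℕ →₀ A) →ₗ[A] M),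
      β ∘ₗ α = F.subtype ∧ (LinearMap.range β).FG := by
  obtain ⟨n, α, β, hαβ⟩ := h F hF
  let e : (Fin n → A) →ₗ[A] (ℕ →₀ A) :=
    Fintype.linearCombination A fun i => Finsupp.single (i : ℕ) (1 : A)
  let q : (ℕ →₀ A) →ₗ[A] (Fin n → A) := LinearMap.pi fun i => Finsupp.lapply (i : ℕ)
  have hqe : q ∘ₗ e = LinearMap.id := by
    refine LinearMap.ext fun x => funext fun i => ?_
    simp [q, e, Fintype.linearCombination_apply, Finsupp.single_apply, Fin.val_inj]
  have hq : Function.Surjective q := fun x => ⟨e x, congr($hqe x)⟩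
  refine ⟨e ∘ₗ α, β ∘ₗ q, ?_, ?_⟩
  · rw [LinearMap.comp_assoc, ← LinearMap.comp_assoc α e q, hqe, LinearMap.id_comp, hαβ]
  · rw [LinearMap.range_comp_of_range_eq_top β (LinearMap.range_eq_top.2 hq),
      LinearMap.range_eq_map]
    exact Module.Finite.fg_top.map β

/-- In a flat module there is an increasing chain of finitely generated submodules `F n` such that
the inclusion of `F n` in `F (n + 1)` factors through `A^(ℕ)`, and such that `F (n + 1)` contains a
prescribed finitely generated submodule `G n (F n)`. -/
theorem LocallyFactorsFree.exists_chain (h : LocallyFactorsFree A M)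
    (G : ℕ → Submodule A M → Submodule A M) (hG : ∀ n F, F.FG → (G n F).FG) :
    ∃ F : ℕ → Submodule A M, ∀ n, (F n).FG ∧ F n ≤ F (n + 1) ∧ G n (F n) ≤ F (n + 1) ∧
      ∃ (α : F n →ₗ[A] (ℕ →₀ A)) (β : (ℕ →₀ A) →ₗ[A] M),
        β ∘ₗ α = (F n).subtype ∧ LinearMap.range β ≤ F (n + 1) := by
  choose α β hαβ hβ using h.exists_factor_finsupp
  let step : ℕ → {F : Submodule A M // F.FG} → {F : Submodule A M // F.FG} := fun n F =>
    ⟨LinearMap.range (β F.1 F.2) ⊔ G n F.1, (hβ F.1 F.2).sup (hG n F.1 F.2)⟩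
  let F : ℕ → {F : Submodule A M // F.FG} := fun n =>
    Nat.rec ⟨⊥, Submodule.fg_bot⟩ (fun n F => step n F) n
  refine ⟨fun n => (F n).1, fun n => ⟨(F n).2, ?_, le_sup_right, α _ (F n).2, β _ (F n).2,
    hαβ _ _, le_sup_left⟩⟩
  refine le_trans (fun x hx => ?_) (le_sup_left : LinearMap.range (β _ (F n).2) ≤ _)
  exact ⟨α _ (F n).2 ⟨x, hx⟩, congr($(hαβ _ (F n).2) ⟨x, hx⟩)⟩

section

variable {L : Type*} [AddCommGroup L] [Module A L]

/-- The map `id - shift` on `L^(ℕ)`, where the shift takes the `n`-th summand to the next one by `τ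
n`. Its cokernel is the direct limit of the sequence `L → L → ⋯` of the maps `τ n`. -/
def telescopeMap (τ : ℕ → L →ₗ[A] L) : (ℕ →₀ L) →ₗ[A] (ℕ →₀ L) :=
  LinearMap.id - Finsupp.lsum ℕ fun n => Finsupp.lsingle (n + 1) ∘ₗ τ n

theorem telescopeMap_single (τ : ℕ → L →ₗ[A] L) (n : ℕ) (l : L) :
    telescopeMap τ (Finsupp.single n l) = Finsupp.single n l - Finsupp.single (n + 1) (τ n l) := by
  simp [telescopeMap]

theorem telescopeMap_apply_zero (τ : ℕ → L →ₗ[A] L) (x : ℕ →₀ L) : telescopeMap τ x 0 = x 0 := by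
  induction x using Finsupp.induction_linear with
  | zero => simp
  | add x y hx hy => simp [hx, hy]
  | single n l => simp [telescopeMap_single]

theorem telescopeMap_apply_succ (τ : ℕ → L →ₗ[A] L) (x : ℕ →₀ L) (n : ℕ) :
    telescopeMap τ x (n + 1) = x (n + 1) - τ n (x n) := by
  induction x using Finsupp.induction_linear with
  | zero => simp
  | add x y hx hy => simp only [map_add, Finsupp.add_apply, hx, hy]; abel
  | single m l =>
    rw [telescopeMap_single]
    by_cases h : m = n
    · subst h; simp
    · simp [Finsupp.single_apply, h]

theorem telescopeMap_injective (τ : ℕ → L →ₗ[A] L) : Function.Injective (telescopeMap τ) := by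
  rw [injective_iff_map_eq_zero]
  intro x hx
  ext n
  induction n with
  | zero => rw [← telescopeMap_apply_zero τ, hx]
  | succ n ih =>
    have := telescopeMap_apply_succ τ x n
    rw [ih, hx] at this
    simpa using this.symm

/-- Modulo the range of the telescope map, every element is concentrated in degree `n`, for all
large `n`. -/
theorem exists_sub_single_mem_range_telescopeMap (τ : ℕ → L →ₗ[A] L) (x : ℕ →₀ L) :
    ∃ N, ∀ n ≥ N, ∃ l, x - Finsupp.single n l ∈ LinearMap.range (telescopeMap τ) := by
  induction x using Finsupp.induction_linear with
  | zero => exact ⟨0, fun n _ => ⟨0, by simp⟩⟩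
  | add x y hx hy =>
    obtain ⟨N, hN⟩ := hx
    obtain ⟨N', hN'⟩ := hy
    refine ⟨max N N', fun n hn => ?_⟩
    obtain ⟨l, hl⟩ := hN n (le_trans (le_max_left _ _) hn)
    obtain ⟨l', hl'⟩ := hN' n (le_trans (le_max_right _ _) hn)
    refine ⟨l + l', ?_⟩
    rw [Finsupp.single_add, add_sub_add_comm]
    exact add_mem hl hl'
  | single m l =>
    refine ⟨m, fun n hn => ?_⟩
    induction n, hn using Nat.le_induction with
    | base => exact ⟨l, by simp⟩
    | succ n _ ih =>
      obtain ⟨l', hl'⟩ := ih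
      refine ⟨τ n l', ?_⟩
      have := add_mem hl' ⟨Finsupp.single n l', telescopeMap_single τ n l'⟩
      rwa [sub_add_sub_cancel] at this

/-- If `M` is the union of submodules `F n` and the inclusion of each `F n` in `F (n + 1)` factors
as `β n ∘ α n` through `L`, then `M` is the direct limit of `L → L → ⋯` along the maps `α (n + 1) ∘
β n`. -/
theorem telescopeMap_exact (F : ℕ → Submodule A M) (hF : ∀ m, ∃ n, m ∈ F n)
    (α : ∀ n, F n →ₗ[A] L) (β : ℕ → L →ₗ[A] M) (hαβ : ∀ n (x : F n), β n (α n x) = x)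
    (hβ : ∀ n x, β n x ∈ F (n + 1)) :
    Function.Exact (telescopeMap fun n => α (n + 1) ∘ₗ (β n).codRestrict (F (n + 1)) (hβ n))
      (Finsupp.lsum ℕ β) ∧ Function.Surjective (Finsupp.lsum ℕ β) := by
  set τ : ℕ → L →ₗ[A] L := fun n => α (n + 1) ∘ₗ (β n).codRestrict (F (n + 1)) (hβ n)
  have hτ : ∀ n l, β (n + 1) (τ n l) = β n l := fun n l => hαβ (n + 1) ⟨β n l, hβ n l⟩
  have h0 : Finsupp.lsum ℕ β ∘ₗ telescopeMap τ = 0 := by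
    refine Finsupp.lhom_ext fun n l => ?_
    rw [LinearMap.comp_apply, telescopeMap_single, map_sub, Finsupp.lsum_single,
      Finsupp.lsum_single, hτ, sub_self, LinearMap.zero_apply]
  refine ⟨fun x => ⟨fun hx => ?_, ?_⟩, fun m => ?_⟩
  · obtain ⟨N, hN⟩ := exists_sub_single_mem_range_telescopeMap τ x
    obtain ⟨l, y, hy⟩ := hN N le_rfl
    have h1 : β N l = 0 := by
      have h2 := congr($h0 y)
      rw [LinearMap.comp_apply, hy, map_sub, hx] at h2
      simpa using h2
    -- `β N l = 0` implies that `l` dies one step later, so `single N l` is in the range as well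
    have h2 : τ N l = 0 := by
      have : (β N).codRestrict (F (N + 1)) (hβ N) l = 0 := Subtype.ext h1
      simp [τ, this]
    refine ⟨y + Finsupp.single N l, ?_⟩
    rw [map_add, hy, telescopeMap_single, h2]
    simp
  · rintro ⟨y, rfl⟩
    exact congr($h0 y)
  · obtain ⟨n, hn⟩ := hF m
    exact ⟨Finsupp.single n (α n ⟨m, hn⟩), by simp [hαβ]⟩

end

/-- A countably generated flat module is a direct limit of a sequence of free modules, so it has a
free resolution of length one. -/
theorem LocallyFactorsFree.exists_resolution (h : LocallyFactorsFree A M)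
    (hM : CountablyGenerated A M) :
    ∃ (d : (ℕ →₀ ℕ →₀ A) →ₗ[A] (ℕ →₀ ℕ →₀ A)) (ε : (ℕ →₀ ℕ →₀ A) →ₗ[A] M),
      Function.Injective d ∧ Function.Exact d ε ∧ Function.Surjective ε := by
  obtain ⟨S, hS, hspan⟩ := hM
  obtain ⟨c, hc⟩ : ∃ c : ℕ → M, S ⊆ Set.range c := by
    rcases S.eq_empty_or_nonempty with rfl | hne
    · exact ⟨0, Set.empty_subset _⟩
    · obtain ⟨c, hc⟩ := hS.exists_eq_range hne
      exact ⟨c, hc.le⟩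
  obtain ⟨F, hF⟩ := h.exists_chain (fun n _ => Submodule.span A {c n})
    (fun n _ _ => Submodule.fg_span_singleton _)
  have hmono : Monotone F := monotone_nat_of_le_succ fun n => (hF n).2.1
  have htop : ⨆ n, F n = ⊤ := by
    rw [eq_top_iff, ← hspan, Submodule.span_le]
    intro x hx
    obtain ⟨n, rfl⟩ := hc hx
    exact Submodule.mem_iSup_of_mem (n + 1) ((hF n).2.2.1 (Submodule.mem_span_singleton_self _))
  choose α β hαβ hβ using fun n => (hF n).2.2.2
  obtain ⟨h1, h2⟩ := telescopeMap_exact F (fun m =>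
      (Submodule.mem_iSup_of_directed F hmono.directed_le).1 (htop ▸ Submodule.mem_top))
    α β (fun n x => congr($(hαβ n) x)) (fun n x => hβ n ⟨x, rfl⟩)
  exact ⟨_, _, telescopeMap_injective _, h1, h2⟩

/-- By Schanuel's lemma, if `M` has a projective resolution of length one, then the kernel of every
surjection from a projective module `H` to `M` is projective: here it is exhibited as a direct
summand of `H × P`. -/
theorem projective_ker_of_resolution {H P Q : Type*} [AddCommGroup H] [Module A H]
    [AddCommGroup P] [Module A P] [AddCommGroup Q] [Module A Q] [Module.Projective A H]
    [Module.Projective A P] [Module.Projective A Q] {d : P →ₗ[A] Q} {ε : Q →ₗ[A] M}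
    (hd : Function.Injective d) (hex : Function.Exact d ε) (hε : Function.Surjective ε)
    {π : H →ₗ[A] M} (hπ : Function.Surjective π) : Module.Projective A (LinearMap.ker π) := by
  obtain ⟨l, hl⟩ := Module.projective_lifting_property π ε hπ
  obtain ⟨μ, hμ⟩ := Module.projective_lifting_property ε π hε
  have hl' : ∀ q, π (l q) = ε q := fun q => congr($hl q)
  have hμ' : ∀ h, ε (μ h) = π h := fun h => congr($hμ h)
  have hεd : ∀ p, ε (d p) = 0 := fun p => hex.apply_apply_eq_zero p
  let e := LinearEquiv.ofInjective d hd
  let w : LinearMap.ker π →ₗ[A] P := e.symm.toLinearMap ∘ₗ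
    (μ ∘ₗ (LinearMap.ker π).subtype).codRestrict (LinearMap.range d) (fun x =>
      (hex _).1 (by simp [hμ']))
  have hw : ∀ x : LinearMap.ker π, d (w x) = μ x := fun x => by
    have := congrArg Subtype.val (e.apply_symm_apply
      ((μ ∘ₗ (LinearMap.ker π).subtype).codRestrict (LinearMap.range d) (fun x =>
        (hex _).1 (by simp [hμ'])) x))
    exact this
  let r : H × P →ₗ[A] LinearMap.ker π :=
    ((LinearMap.id - l ∘ₗ μ).coprod (l ∘ₗ d)).codRestrict (LinearMap.ker π) (fun x => by
      simp [hl', hμ', hεd])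
  refine Module.Projective.of_split ((LinearMap.ker π).subtype.prod w) r ?_
  refine LinearMap.ext fun x => Subtype.ext ?_
  change (x - l (μ x)) + l (d (w x)) = (x : H)
  rw [hw, sub_add_cancel]

end Telescope

/-! ### Embedding in sums of the dualising module -/

section Cosyzygy

variable {R : Type*} {A : Type*} [CommRing R] [Ring A] [Algebra R A]
  {M : Type*} [AddCommGroup M] [Module R M] [Module A M] [IsScalarTower R A M]

/-- Evaluation of functionals at `1 ∈ A`. -/
def DualisingModule.evalOne (R A : Type*) [CommRing R] [Ring A] [Algebra R A] :
    DualisingModule R A →ₗ[R] R :=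
  (LinearMap.applyₗ (1 : A) : (A →ₗ[R] R) →ₗ[R] R)

/-- A module that is a direct summand of `R^(I)` over `R` embeds in `ω^(I)` by an `A`-linear map
that splits over `R`. The map `j` sends `m` to the functionals `x ↦ i (x m) k` for `k ∈ I`; it takes
values in the direct sum since `A` is a finitely generated `R`-module. -/
theorem exists_embedding_dualising [Module.Finite R A] {I : Type*} (i : M →ₗ[R] (I →₀ R))
    (r : (I →₀ R) →ₗ[R] M) (hir : ∀ m, r (i m) = m) :
    ∃ (j : M →ₗ[A] (I →₀ DualisingModule R A)) (ρ : (I →₀ DualisingModule R A) →ₗ[R] M),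
      ∀ m, ρ (j m) = m := by
  obtain ⟨n, a, ha⟩ := Module.Finite.exists_fin (R := R) (M := A)
  let φ : M → I → DualisingModule R A := fun m k =>
    (Finsupp.lapply k ∘ₗ i ∘ₗ (LinearMap.toSpanSingleton A M m).restrictScalars R : A →ₗ[R] R)
  have hφ : ∀ m k x, (show A →ₗ[R] R from φ m k) x = i (x • m) k := fun m k x => rfl
  have hfin : ∀ m, (Function.support (φ m)).Finite := by
    intro m
    refine (Set.finite_iUnion fun t : Fin n => (i (a t • m)).support.finite_toSet).subset ?_
    intro k hk
    by_contra h
    simp only [Set.mem_iUnion, Finset.mem_coe, Finsupp.mem_support_iff, not_exists, not_not] at h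
    exact hk (LinearMap.ext_on_range (g := (0 : A →ₗ[R] R)) ha h)
  let j : M →ₗ[A] (I →₀ DualisingModule R A) :=
    { toFun := fun m => Finsupp.ofSupportFinite (φ m) (hfin m)
      map_add' := fun m m' => by
        refine Finsupp.ext fun k => LinearMap.ext fun x => ?_
        refine (congrArg (fun z => i z k) (smul_add x m m')).trans ?_
        rw [map_add]
        rfl
      map_smul' := fun b m => by
        refine Finsupp.ext fun k => LinearMap.ext fun x => ?_
        exact (congrArg (fun z => i z k) (mul_smul x b m)).symm }
  refine ⟨j, r ∘ₗ Finsupp.mapRange.linearMap (DualisingModule.evalOne R A), fun m => ?_⟩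
  rw [LinearMap.comp_apply]
  refine (congrArg r ?_).trans (hir m)
  ext k
  exact congrArg (fun z => i z k) (one_smul A m)

theorem IsFrobeniusAlgebra.dualising_split (hA : IsFrobeniusAlgebra R A) :
    ∃ (n : ℕ) (i : DualisingModule R A →ₗ[A] (Fin n → A))
      (r : (Fin n → A) →ₗ[A] DualisingModule R A), r ∘ₗ i = LinearMap.id :=
  (hA.add_eq (DualisingModule R A)).1
    ⟨1, LinearMap.pi fun _ => LinearMap.id, LinearMap.proj 0, rfl⟩

theorem IsFrobeniusAlgebra.projective_dualising (hA : IsFrobeniusAlgebra R A) :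
    Module.Projective A (DualisingModule R A) := by
  obtain ⟨n, i, r, h⟩ := hA.dualising_split
  exact Module.Projective.of_split i r h

theorem projective_base_of_projective (hA : Module.Projective R A) (hM : Module.Projective A M) :
    Module.Projective R M := by
  obtain ⟨s, hs⟩ := Module.projective_def'.1 hM
  have := projective_finsupp hA M
  exact Module.Projective.of_split (s.restrictScalars R)
    ((Finsupp.linearCombination A id).restrictScalars R) (LinearMap.ext fun m => congr($hs m))

theorem countablyGenerated_finsupp {B P : Type*} [Ring B] [AddCommGroup P] [Module B P]
    [Module.Finite B P] (I : Type*) [Countable I] : CountablyGenerated B (I →₀ P) := by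
  obtain ⟨s, hs⟩ := Module.Finite.fg_top (R := B) (M := P)
  refine ⟨⋃ k : I, Finsupp.single k '' s,
    Set.countable_iUnion fun k => (s.countable_toSet.image _), ?_⟩
  rw [eq_top_iff]
  rintro x -
  induction x using Finsupp.induction_linear with
  | zero => exact zero_mem _
  | add x y hx hy => exact add_mem hx hy
  | single k l =>
    have hl : l ∈ Submodule.span B (s : Set P) := hs ▸ Submodule.mem_top
    have := Submodule.mem_map_of_mem (f := Finsupp.lsingle k) hl
    rw [Submodule.map_span] at this
    exact Submodule.span_mono (Set.subset_iUnion (fun k : I => Finsupp.single k '' (s : Set P)) k)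
      this

theorem isNoetherianRing_of_finite (R A : Type*) [CommRing R] [Ring A] [Algebra R A]
    [IsNoetherianRing R] [Module.Finite R A] : IsNoetherianRing A :=
  isNoetherian_of_tower R inferInstance

/-- Over a fibre of a Frobenius algebra, flat modules are injective. -/
theorem EquationallyFlat.baer_of_frobenius_fibre (hA : IsFrobeniusAlgebra R A)
    {p : PrimeSpectrum R} {W : Type*} [AddCommGroup W] [Module (p.asIdeal.Fiber A) W]
    (h : EquationallyFlat (p.asIdeal.Fiber A) W) : Module.Baer (p.asIdeal.Fiber A) W := by
  have := hA.finite
  have := isNoetherianRing_of_finite p.asIdeal.ResidueField (p.asIdeal.Fiber A)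
  exact h.locallyFactorsFree.baer (hA.baer_fibre p)

theorem exists_embedding_projective (hA : IsFrobeniusAlgebra R A) (hM : Module.Projective R M) :
    ∃ (j : M →ₗ[A] (M →₀ DualisingModule R A)) (ρ : (M →₀ DualisingModule R A) →ₗ[R] M),
      ∀ m, ρ (j m) = m := by
  have := hA.finite
  obtain ⟨i, hi⟩ := Module.projective_def'.1 hM
  exact exists_embedding_dualising i (Finsupp.linearCombination R id) fun m => congr($hi m)

/-- A flat fibre of an `R`-projective module is injective, and it embeds in a fibre of `ω^(M)`,
which is projective. So it is a direct summand, hence projective. -/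
theorem projective_fibre_of_equationallyFlat (hA : IsFrobeniusAlgebra R A)
    (hM : Module.Projective R M) {p : PrimeSpectrum R}
    (h : EquationallyFlat (p.asIdeal.Fiber A) (ModuleFibre R A M p)) :
    Module.Projective (p.asIdeal.Fiber A) (ModuleFibre R A M p) := by
  obtain ⟨j, ρ, hρ⟩ := exists_embedding_projective hA hM
  have : Module.Projective (p.asIdeal.Fiber A) (ModuleFibre R A (M →₀ DualisingModule R A) p) :=
    ModuleFibre.projective_of_projective (projective_finsupp hA.projective_dualising M)
  exact (h.baer_of_frobenius_fibre hA).projective_of_injective (ModuleFibre.map p j)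
    (ModuleFibre.map_injective hρ)

theorem EquationallyFlat.fibrewiseProjective (hA : IsFrobeniusAlgebra R A)
    (hM : Module.Projective R M) (h : EquationallyFlat A M) : FibrewiseProjective R A M :=
  fun p => projective_fibre_of_equationallyFlat hA hM (h.fibre p)

/-- The countably generated case. Embed `M` in a countable direct sum `H` of copies of `ω`, with a
cokernel that is projective over `R`. The fibres of the cokernel are projective, as those of `M` are
injective; hence the cokernel is flat and has a free resolution of length one. As `H` is projective,
so is its kernel `M`. -/
theorem projective_of_countablyGenerated [IsNoetherianRing R] (hA : IsFrobeniusAlgebra R A)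
    (hM : Module.Projective R M) (h : EquationallyFlat A M) (hc : CountablyGenerated A M) :
    Module.Projective A M := by
  have := hA.finite
  have := isNoetherianRing_of_finite R A
  obtain ⟨S, hS, hspan⟩ := hc
  have := hS.to_subtype
  obtain ⟨n, a, ha⟩ := Module.Finite.exists_fin (R := R) (M := A)
  -- the elements `a t • x` generate `M` over `R`, so that `M` is a direct summand of `R^(I)`
  -- with `I` countable
  let I := Fin n × S
  let r : (I →₀ R) →ₗ[R] M := Finsupp.linearCombination R fun k => a k.1 • (k.2 : M)
  have hr : Function.Surjective r := by
    rw [← LinearMap.range_eq_top, eq_top_iff]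
    rintro m -
    have hm : m ∈ Submodule.span A S := hspan ▸ Submodule.mem_top
    rw [Finsupp.range_linearCombination]
    have hgen : ∀ (b : A) (x : S), b • (x : M) ∈
        Submodule.span R (Set.range fun k : I => a k.1 • (k.2 : M)) := by
      intro b x
      have hb : b ∈ Submodule.span R (Set.range a) := ha ▸ Submodule.mem_top
      induction hb using Submodule.span_induction with
      | mem b hb =>
        obtain ⟨t, rfl⟩ := hb
        exact Submodule.subset_span ⟨(t, x), rfl⟩
      | zero => rw [zero_smul]; exact zero_mem _
      | add b b' _ _ h h' => rw [add_smul]; exact add_mem h h'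
      | smul c b _ h => rw [smul_assoc]; exact Submodule.smul_mem _ c h
    have hsmul : ∀ (b : A), ∀ x ∈ Submodule.span R (Set.range fun k : I => a k.1 • (k.2 : M)),
        b • x ∈ Submodule.span R (Set.range fun k : I => a k.1 • (k.2 : M)) := by
      intro b x hx
      induction hx using Submodule.span_induction with
      | mem x hx =>
        obtain ⟨k, rfl⟩ := hx
        simpa only [← mul_smul] using hgen (b * a k.1) k.2
      | zero => rw [smul_zero]; exact zero_mem _
      | add x y _ _ hx hy => rw [smul_add]; exact add_mem hx hy
      | smul c x _ hx => rw [smul_comm]; exact Submodule.smul_mem _ c hx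
    induction hm using Submodule.span_induction with
    | mem x hx => simpa using hgen 1 ⟨x, hx⟩
    | zero => exact zero_mem _
    | add x y _ _ hx hy => exact add_mem hx hy
    | smul b x _ hx => exact hsmul b x hx
  obtain ⟨i, hi⟩ := Module.projective_lifting_property r LinearMap.id hr
  obtain ⟨j, ρ, hρ⟩ := exists_embedding_dualising (A := A) i r fun m => congr($hi m)
  have hj : Function.Injective j := Function.LeftInverse.injective (g := ρ) hρ
  let H := I →₀ DualisingModule R A
  have hH : Module.Projective A H := projective_finsupp hA.projective_dualising I
  let π : H →ₗ[A] H ⧸ LinearMap.range j := (LinearMap.range j).mkQ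
  have hπ : Function.Surjective π := Submodule.mkQ_surjective _
  have hex : Function.Exact j π := LinearMap.exact_map_mkQ_range j
  have hCR : Module.Projective R (H ⧸ LinearMap.range j) := by
    have : Module.Projective R H := projective_base_of_projective hA.projective hH
    exact projective_right_of_retraction (f := j.restrictScalars R) (g := π.restrictScalars R)
      hex hπ (LinearMap.ext hρ)
  have hCF : FibrewiseProjective R A (H ⧸ LinearMap.range j) :=
    FibrewiseProjective.right hex hπ hρ (FibrewiseProjective.of_projective hH)
      fun p => (h.fibre p).baer_of_frobenius_fibre hA
  have hCE := hCF.equationallyFlat hA.projective hCR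
  have hω : Module.Finite A (DualisingModule R A) := by
    obtain ⟨n, i, r, hir⟩ := hA.dualising_split
    exact Module.Finite.of_surjective r fun x => ⟨i x, congr($hir x)⟩
  obtain ⟨d, ε, hd, hdε, hε⟩ := hCE.locallyFactorsFree.exists_resolution
    ((countablyGenerated_finsupp I).of_surjective π hπ)
  have hfree : Module.Projective A (ℕ →₀ ℕ →₀ A) := projective_finsupp inferInstance ℕ
  have hker := projective_ker_of_resolution (P := ℕ →₀ ℕ →₀ A) (Q := ℕ →₀ ℕ →₀ A) hd hdε hε hπ
  have e : LinearMap.ker π ≃ₗ[A] M :=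
    (LinearEquiv.ofEq _ _ (Submodule.ker_mkQ _)).trans (LinearEquiv.ofInjective j hj).symm
  exact Module.Projective.of_equiv e

end Cosyzygy

/-! ### Adapted submodules -/

section Adapted

variable {R : Type*} {A : Type*} [CommRing R] [Ring A] [Algebra R A]
  {M : Type*} [AddCommGroup M] [Module R M] [Module A M] [IsScalarTower R A M]
  {I : Type*}

/-- Let `M` be a direct summand of `R^(I)`, with inclusion `i` and projection `r`. The `A`-submodule
`N` is adapted to the subset `J` of `I` if `i N ⊆ R^(J)` and `r R^(J) ⊆ N`. The splitting then
restricts to `N` and descends to `M ⧸ N`, and so both are projective over `R`. -/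
structure IsAdapted (i : M →ₗ[R] (I →₀ R)) (r : (I →₀ R) →ₗ[R] M) (N : Submodule A M)
    (J : Set I) : Prop where
  apply_eq_zero : ∀ n ∈ N, ∀ k ∉ J, i n k = 0
  single_mem : ∀ k ∈ J, r (Finsupp.single k 1) ∈ N

variable {i : M →ₗ[R] (I →₀ R)} {r : (I →₀ R) →ₗ[R] M} {N : Submodule A M} {J : Set I}

theorem mem_of_single_mem {x : I →₀ R} (h : ∀ k, x k ≠ 0 → r (Finsupp.single k 1) ∈ N) :
    r x ∈ N := by
  have hx : x = ∑ k ∈ x.support, x k • Finsupp.single k 1 := by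
    conv_lhs => rw [← Finsupp.sum_single x]
    simp [Finsupp.sum]
  rw [hx, map_sum]
  refine sum_mem fun k hk => ?_
  rw [map_smul]
  exact N.smul_of_tower_mem _ (h k (Finsupp.mem_support_iff.1 hk))

/-- The projection of `R^(I)` onto `R^(J)`, as an endomorphism of `R^(I)`. -/
def Finsupp.filterLinear (R : Type*) [CommRing R] {I : Type*} (J : Set I) :
    (I →₀ R) →ₗ[R] (I →₀ R) := by
  classical
  exact
  { toFun := fun x => x.filter (· ∈ J)
    map_add' := fun _ _ => Finsupp.filter_add
    map_smul' := fun _ _ => Finsupp.filter_smul }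

theorem Finsupp.filterLinear_apply_of_mem (x : I →₀ R) {k : I} (hk : k ∈ J) :
    Finsupp.filterLinear R J x k = x k := by
  classical
  exact Finsupp.filter_apply_pos (· ∈ J) x hk

theorem Finsupp.filterLinear_apply_of_notMem (x : I →₀ R) {k : I} (hk : k ∉ J) :
    Finsupp.filterLinear R J x k = 0 := by
  classical
  exact Finsupp.filter_apply_neg (· ∈ J) x hk

theorem IsAdapted.filter_mem (h : IsAdapted i r N J) (x : I →₀ R) :
    r (Finsupp.filterLinear R J x) ∈ N := by
  refine mem_of_single_mem fun k hk => h.single_mem k ?_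
  by_contra hkJ
  exact hk (Finsupp.filterLinear_apply_of_notMem x hkJ)

theorem IsAdapted.projective (h : IsAdapted i r N J) (hir : ∀ m, r (i m) = m) :
    Module.Projective R N := by
  refine Module.Projective.of_split (M := I →₀ R) (i ∘ₗ N.subtype.restrictScalars R)
    ((r ∘ₗ Finsupp.filterLinear R J).codRestrict (N.restrictScalars R) h.filter_mem) ?_
  refine LinearMap.ext fun n => Subtype.ext ?_
  change r (Finsupp.filterLinear R J (i n)) = n
  have : Finsupp.filterLinear R J (i n) = i n := by
    ext k
    by_cases hk : k ∈ J
    · exact Finsupp.filterLinear_apply_of_mem _ hk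
    · rw [Finsupp.filterLinear_apply_of_notMem _ hk, h.apply_eq_zero n n.2 k hk]
  rw [this, hir]

/-- If `N` is adapted to `J`, then `M ⧸ N` is a direct summand of `R^(I)`, with inclusion `i'`
obtained from `i` by discarding the coordinates in `J`, and projection induced by `r`. -/
theorem IsAdapted.exists_quotient (h : IsAdapted i r N J) (hir : ∀ m, r (i m) = m) :
    ∃ (i' : M ⧸ N →ₗ[R] (I →₀ R)) (r' : (I →₀ R) →ₗ[R] M ⧸ N),
      (∀ q, r' (i' q) = q) ∧ (∀ x, r' x = N.mkQ (r x)) ∧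
      ∀ m, ∀ k ∉ J, i' (N.mkQ m) k = i m k := by
  let i' : M ⧸ N →ₗ[R] (I →₀ R) :=
    (N.restrictScalars R).liftQ (Finsupp.filterLinear R Jᶜ ∘ₗ i) (fun n hn => by
      rw [LinearMap.mem_ker, LinearMap.comp_apply]
      ext k
      by_cases hk : k ∈ J
      · exact Finsupp.filterLinear_apply_of_notMem _ (not_not.2 hk)
      · rw [Finsupp.filterLinear_apply_of_mem _ hk]
        exact h.apply_eq_zero n hn k hk) ∘ₗ
      (Submodule.Quotient.restrictScalarsEquiv R N).symm.toLinearMap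
  have hi' : ∀ m, i' (N.mkQ m) = Finsupp.filterLinear R Jᶜ (i m) := fun m => rfl
  refine ⟨i', N.mkQ.restrictScalars R ∘ₗ r, fun q => ?_, fun _ => rfl, fun m k hk => ?_⟩
  · obtain ⟨m, rfl⟩ := N.mkQ_surjective q
    rw [hi', LinearMap.comp_apply, LinearMap.restrictScalars_apply, ← sub_eq_zero, ← map_sub,
      ← LinearMap.mem_ker, Submodule.ker_mkQ]
    have : r (Finsupp.filterLinear R Jᶜ (i m)) - m = r (Finsupp.filterLinear R Jᶜ (i m) - i m) := by
      rw [map_sub, hir]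
    rw [this]
    refine mem_of_single_mem fun k hk => h.single_mem k ?_
    by_contra hkJ
    exact hk (by rw [Finsupp.sub_apply, Finsupp.filterLinear_apply_of_mem _ hkJ, sub_self])
  · rw [hi', Finsupp.filterLinear_apply_of_mem _ hk]

/-- Every index `k₀` belongs to a set `J` to which a countably generated flat submodule is adapted.
The submodule is the union of a chain as in `LocallyFactorsFree.exists_chain`, where `F (n + 1)` is
made to contain the images under `r` of the basis vectors that occur in `i (F n)`. -/
theorem exists_adapted_countable [Module.Finite R A] [IsNoetherianRing A]
    (hM : EquationallyFlat A M) (i : M →ₗ[R] (I →₀ R)) (r : (I →₀ R) →ₗ[R] M) (k₀ : I) :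
    ∃ (N : Submodule A M) (J : Set I), IsAdapted i r N J ∧ k₀ ∈ J ∧ CountablyGenerated A N ∧
      EquationallyFlat A N := by
  -- the indices that occur in `i F`; there are finitely many if `F` is finitely generated over `A`,
  -- hence over `R`
  let supp : Submodule A M → Set I := fun F => {k | ∃ x ∈ F, i x k ≠ 0}
  have hsupp : ∀ F : Submodule A M, F.FG → (supp F).Finite := by
    intro F hF
    have : Module.Finite A F := Module.Finite.iff_fg.2 hF
    have : Module.Finite R F := Module.Finite.trans A F
    obtain ⟨s, hs⟩ := Module.Finite.fg_top (R := R) (M := F)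
    refine (s.finite_toSet.biUnion fun x _ => (i x).support.finite_toSet).subset ?_
    rintro k ⟨x, hx, hk⟩
    by_contra h
    simp only [Set.mem_iUnion, Finset.mem_coe, Finsupp.mem_support_iff, not_exists, not_not] at h
    have h0 : (Finsupp.lapply k ∘ₗ i ∘ₗ F.subtype.restrictScalars R : F →ₗ[R] R) = 0 :=
      LinearMap.ext_on hs fun y hy => h y hy
    exact hk congr($h0 ⟨x, hx⟩)
  obtain ⟨F, hF⟩ := hM.locallyFactorsFree.exists_chain
    (fun _ F => Submodule.span A ((fun k => r (Finsupp.single k 1)) '' (insert k₀ (supp F))))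
    (fun _ F hF => Submodule.fg_span (((hsupp F hF).insert k₀).image _))
  have hmono : Monotone F := monotone_nat_of_le_succ fun n => (hF n).2.1
  have hmem : ∀ {x}, x ∈ ⨆ n, F n ↔ ∃ n, x ∈ F n :=
    Submodule.mem_iSup_of_directed F hmono.directed_le
  refine ⟨⨆ n, F n, insert k₀ (⋃ n, supp (F n)), ⟨fun x hx k hk => ?_, fun k hk => ?_⟩,
    Set.mem_insert _ _, ?_, ?_⟩
  · obtain ⟨n, hn⟩ := hmem.1 hx
    by_contra h
    exact hk (Set.mem_insert_of_mem _ (Set.mem_iUnion.2 ⟨n, x, hn, h⟩))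
  · obtain ⟨n, hn⟩ : ∃ n, k ∈ insert k₀ (supp (F n)) := by
      rcases hk with rfl | hk
      · exact ⟨0, Set.mem_insert _ _⟩
      · obtain ⟨n, hn⟩ := Set.mem_iUnion.1 hk
        exact ⟨n, Set.mem_insert_of_mem _ hn⟩
    exact hmem.2 ⟨n + 1, (hF n).2.2.1 (Submodule.subset_span ⟨k, hn, rfl⟩)⟩
  · choose s hs using fun n => (hF n).1
    have hspan : ⨆ n, F n = Submodule.span A (⋃ n, (s n : Set M)) := by
      rw [Submodule.span_iUnion]
      exact iSup_congr fun n => (hs n).symm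
    rw [hspan]
    exact ⟨_, (Set.countable_iUnion fun n => (s n).countable_toSet).preimage
      Subtype.val_injective, Submodule.span_span_coe_preimage⟩
  · intro l a m h0
    choose n hn using fun t => hmem.1 (m t).2
    -- move the relation to the free module through which a stage containing all `m t` factors
    obtain ⟨α, β, hαβ, hβ⟩ := (hF (Finset.univ.sup n)).2.2.2
    have hm : ∀ t, (m t : M) ∈ F (Finset.univ.sup n) := fun t =>
      hmono (Finset.le_sup (Finset.mem_univ t)) (hn t)
    have hβ' : ∀ x, β x ∈ ⨆ n, F n := fun x => hmem.2 ⟨_, hβ ⟨x, rfl⟩⟩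
    have hfree : EquationallyFlat A (ℕ →₀ A) :=
      (IsFlatModule.of_projective (A := A) (M := ℕ →₀ A) inferInstance).equationallyFlat
    obtain ⟨k, b, y, hy, hb⟩ := hfree l a (fun t => α ⟨m t, hm t⟩) (by
      simp_rw [← map_smul, ← map_sum]
      convert map_zero α
      ext
      simpa using congrArg Subtype.val h0)
    refine ⟨k, b, fun j => ⟨β (y j), hβ' _⟩, fun t => Subtype.ext ?_, hb⟩
    have h1 : β (α ⟨m t, hm t⟩) = m t := congr($hαβ ⟨m t, hm t⟩)
    rw [hy, map_sum] at h1
    rw [← h1]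
    simp

end Adapted

/-! ### From countably generated to arbitrary modules -/

section Zorn

theorem projective_sSup {A M : Type*} [Ring A] [AddCommGroup M] [Module A M]
    {S : Set (Submodule A M)} (hS : sSupIndep S) (h : ∀ N ∈ S, Module.Projective A N) :
    Module.Projective A (sSup S : Submodule A M) := by
  classical
  have hinj := (sSupIndep_iff S).1 hS |>.dfinsupp_lsum_injective
  have : ∀ N : S, Module.Projective A (N : Submodule A M) := fun N => h N N.2
  rw [sSup_eq_iSup', Submodule.iSup_eq_range_dfinsupp_lsum]
  exact Module.Projective.of_equiv (LinearEquiv.ofInjective _ hinj)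

theorem sSupIndep_insert {α : Type*} [CompleteLattice α] [IsModularLattice α] {S : Set α} {Q : α}
    (hS : sSupIndep S) (hQ : Disjoint Q (sSup S)) : sSupIndep (insert Q S) := by
  intro a ha
  by_cases haQ : a = Q
  · subst haQ
    refine hQ.mono_right (sSup_le_sSup ?_)
    rintro b ⟨hb | hb, hne⟩
    · exact (hne hb).elim
    · exact hb
  · have haS : a ∈ S := ha.resolve_left haQ
    have h1 : Disjoint a (sSup (S \ {a}) ⊔ Q) := by
      refine (hS haS).disjoint_sup_right_of_disjoint_sup_left (hQ.symm.mono_left ?_)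
      exact sup_le (le_sSup haS) (sSup_le_sSup Set.sdiff_subset)
    refine h1.mono_right (sSup_le ?_)
    rintro b ⟨rfl | hb, hne⟩
    · exact le_sup_right
    · exact le_sup_of_le_left (le_sSup ⟨hb, hne⟩)

variable {R : Type*} {A : Type*} [CommRing R] [IsNoetherianRing R] [Ring A] [Algebra R A]
  {M : Type*} [AddCommGroup M] [Module R M] [Module A M] [IsScalarTower R A M]

/-- Let `N` be a projective adapted submodule of a flat module `M`. Then `M ⧸ N` has projective
fibres, hence is flat, and contains a countably generated adapted flat submodule; the latter is
projective, so it lifts to a complement `Q` of `N` in a larger adapted submodule. -/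
theorem exists_adapted_extension (hA : IsFrobeniusAlgebra R A) (hM : EquationallyFlat A M)
    {I : Type*} {i : M →ₗ[R] (I →₀ R)} {r : (I →₀ R) →ₗ[R] M} (hir : ∀ m, r (i m) = m)
    {N : Submodule A M} (hN : Module.Projective A N) {J : Set I} (hJ : IsAdapted i r N J)
    (k₀ : I) :
    ∃ Q : Submodule A M, Module.Projective A Q ∧ Disjoint Q N ∧
      r (Finsupp.single k₀ 1) ∈ Q ⊔ N ∧ ∃ J', IsAdapted i r (Q ⊔ N) J' := by
  have := hA.finite
  have := isNoetherianRing_of_finite R A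
  have hMR : Module.Projective R M := Module.Projective.of_split i r (LinearMap.ext hir)
  obtain ⟨i', r', hir', hr', hi'⟩ := hJ.exists_quotient hir
  have hQR : Module.Projective R (M ⧸ N) := Module.Projective.of_split i' r' (LinearMap.ext hir')
  have hNE : EquationallyFlat A N := (IsFlatModule.of_projective hN).equationallyFlat
  have hQF : FibrewiseProjective R A (M ⧸ N) := by
    obtain ⟨ρ, hρ⟩ := N.exists_base_retraction hQR
    exact FibrewiseProjective.right (f := N.subtype) (LinearMap.exact_subtype_mkQ N)
      N.mkQ_surjective hρ (hM.fibrewiseProjective hA hMR)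
      fun p => (hNE.fibre p).baer_of_frobenius_fibre hA
  obtain ⟨N', K, hK, hk₀, hcount, hE⟩ := exists_adapted_countable
    (hQF.equationallyFlat hA.projective hQR) i' r' k₀
  have hN' : Module.Projective A N' :=
    projective_of_countablyGenerated hA (hK.projective hir') hE hcount
  -- the complement `Q` is the range of a lift `s : N' → M`
  obtain ⟨s, hs⟩ := Module.projective_lifting_property N.mkQ N'.subtype N.mkQ_surjective
  have hs' : ∀ x, N.mkQ (s x) = x := fun x => congr($hs x)
  have hsup : LinearMap.range s ⊔ N = N'.comap N.mkQ := by
    refine le_antisymm (sup_le ?_ ?_) fun m hm => ?_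
    · rintro _ ⟨x, rfl⟩
      rw [Submodule.mem_comap, hs']
      exact x.2
    · intro n hn
      have : N.mkQ n = 0 := by rwa [← LinearMap.mem_ker, Submodule.ker_mkQ]
      rw [Submodule.mem_comap, this]
      exact zero_mem _
    · refine Submodule.mem_sup.2 ⟨s ⟨N.mkQ m, hm⟩, ⟨_, rfl⟩, m - s ⟨N.mkQ m, hm⟩, ?_,
        add_sub_cancel _ _⟩
      refine (Submodule.Quotient.mk_eq_zero N).1 ?_
      change N.mkQ (m - s ⟨N.mkQ m, hm⟩) = 0
      rw [map_sub, hs', sub_self]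
  have hinj : Function.Injective s := fun x y hxy => Subtype.ext (by rw [← hs', hxy, hs'])
  refine ⟨LinearMap.range s, Module.Projective.of_equiv (LinearEquiv.ofInjective s hinj), ?_, ?_,
    J ∪ K, fun n hn k hk => ?_, fun k hk => ?_⟩
  · rw [Submodule.disjoint_def]
    rintro _ ⟨x, rfl⟩ hx
    have h1 := hs' x
    rw [show N.mkQ (s x) = 0 by rwa [← LinearMap.mem_ker, Submodule.ker_mkQ]] at h1
    rw [show x = 0 from Subtype.ext h1.symm, map_zero]
  · rw [hsup, Submodule.mem_comap, ← hr']
    exact hK.single_mem k₀ hk₀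
  · rw [hsup] at hn
    rw [← hi' n k fun h => hk (Or.inl h)]
    exact hK.apply_eq_zero _ hn k fun h => hk (Or.inr h)
  · rcases hk with hk | hk
    · exact Submodule.mem_sup_right (hJ.single_mem k hk)
    · rw [hsup, Submodule.mem_comap, ← hr']
      exact hK.single_mem k hk

/-- Zorn's lemma yields a maximal independent set of projective submodules with adapted sum. By
`exists_adapted_extension` the sum is all of `M`. -/
theorem EquationallyFlat.projective (hA : IsFrobeniusAlgebra R A) (hM : Module.Projective R M)
    (h : EquationallyFlat A M) : Module.Projective A M := by
  obtain ⟨i, hi⟩ := Module.projective_def'.1 hM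
  let r : (M →₀ R) →ₗ[R] M := Finsupp.linearCombination R id
  have hir : ∀ m, r (i m) = m := fun m => congr($hi m)
  let 𝒮 : Set (Set (Submodule A M)) := {S | sSupIndep S ∧ (∀ N ∈ S, Module.Projective A N) ∧
    ∃ J, IsAdapted i r (sSup S) J}
  obtain ⟨S, -, hS⟩ := zorn_subset_nonempty 𝒮 (fun c hc hchain hne => by
    refine ⟨⋃₀ c, ⟨?_, ?_, ?_⟩, fun s hs => Set.subset_sUnion_of_mem hs⟩
    · exact iSupIndep_sUnion_of_directed hchain.directedOn fun S hS => (hc hS).1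
    · rintro N ⟨S, hS, hN⟩
      exact (hc hS).2.1 N hN
    · have hJ : ∀ S : c, ∃ J, IsAdapted i r (sSup S.1) J := fun S => (hc S.2).2.2
      choose J hJ using hJ
      have := hne.to_subtype
      have hsup : sSup (⋃₀ c) = ⨆ S : c, sSup S.1 := by rw [sSup_sUnion, iSup_subtype]
      have hdir : Directed (· ≤ ·) fun S : c => (sSup S.1 : Submodule A M) :=
        fun S T => (hchain.total S.2 T.2).elim (fun h => ⟨T, sSup_le_sSup h, le_rfl⟩)
          fun h => ⟨S, le_rfl, sSup_le_sSup h⟩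
      refine ⟨⋃ S, J S, fun n hn k hk => ?_, fun k hk => ?_⟩
      · rw [hsup, Submodule.mem_iSup_of_directed _ hdir] at hn
        obtain ⟨S, hn⟩ := hn
        exact (hJ S).apply_eq_zero n hn k fun h => hk (Set.mem_iUnion.2 ⟨S, h⟩)
      · obtain ⟨S, hk⟩ := Set.mem_iUnion.1 hk
        exact sSup_le_sSup (Set.subset_sUnion_of_mem S.2) ((hJ S).single_mem k hk)) ∅
    ⟨fun a ha => ha.elim, fun N hN => hN.elim, ∅, fun n hn k _ => by
      rw [sSup_empty, Submodule.mem_bot] at hn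
      simp [hn], fun k hk => hk.elim⟩
  obtain ⟨⟨hind, hproj, J, hJ⟩, hmax⟩ := hS
  have hN := projective_sSup hind hproj
  have htop : sSup S = ⊤ := by
    by_contra hne
    obtain ⟨k₀, hk₀⟩ : ∃ k, r (Finsupp.single k 1) ∉ sSup S := by
      by_contra! hall
      refine hne (eq_top_iff.2 fun m _ => ?_)
      rw [← hir m]
      exact mem_of_single_mem fun k _ => hall k
    obtain ⟨Q, hQ, hdisj, hmem, hJ'⟩ := exists_adapted_extension hA h hir hN hJ k₀
    have hsS : sSup (insert Q S) = Q ⊔ sSup S := sSup_insert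
    -- maximality puts `Q` in `S`, so that `Q ⊔ sSup S = sSup S`
    have hQS : Q ∈ S := hmax ⟨sSupIndep_insert hind hdisj, by
      rintro N (rfl | hN)
      · exact hQ
      · exact hproj N hN, hsS ▸ hJ'⟩ (Set.subset_insert Q S) (Set.mem_insert Q S)
    rw [sup_eq_right.2 (le_sSup hQS)] at hmem
    exact hk₀ hmem
  rw [htop] at hN
  exact Module.Projective.of_equiv (Submodule.topEquiv (R := A) (M := M))

end Zorn

end

theorem proposition3p5 {R : Type*} {A : Type*} {M : Type*} [CommRing R] [IsNoetherianRing R]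
    [Ring A] [Algebra R A] (hA : IsFrobeniusAlgebra R A)
    [AddCommGroup M] [Module R M] [Module A M] [IsScalarTower R A M]
    (hM : Module.Projective R M) :
    List.TFAE [
      IsFlatModule A M,
      Module.Projective A M,
      ∀ p : PrimeSpectrum R, Module.Projective (p.asIdeal.Fiber A) (ModuleFibre R A M p),
      ∀ p : PrimeSpectrum R, IsFlatModule (p.asIdeal.Fiber A) (ModuleFibre R A M p)] := by
  have := hA.finite
  tfae_have 1 → 3 := fun h => h.equationallyFlat.fibrewiseProjective hA hM
  -- fibrewise projective modules are flat, and flat modules are projective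
  tfae_have 3 → 2 := fun h =>
    (FibrewiseProjective.equationallyFlat hA.projective hM h).projective hA hM
  tfae_have 2 → 1 := IsFlatModule.of_projective
  tfae_have 3 → 4 := fun h p => IsFlatModule.of_projective (h p)
  tfae_have 4 → 3 := fun h p => projective_fibre_of_equationallyFlat hA hM (h p).equationallyFlat
  tfae_finish
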